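/- Consider a field of $w\times h$ cells of the square grid with $w,h\ge 4$, surrounded by walls. A metamorphic robotic system (MRS) of size five is a set of five modules on distinct cells whose side-adjacency graph (modules on cells that share a side are adjacent) is connected. At each time $t=0,1,2,\dots$ all modules simultaneously observe, compute and move. A module observes, for each cell whose $x$- and $y$-offset from it are both at most $k$ in absolute value (the visibility range is $k$), whether that cell is empty, occupied by a module, or a wall; it does so in its own local coordinate system, which is right-handed, has its origin at the module and axes parallel to the grid, but an arbitrary orientation (no global compass). From this observation alone, by a deterministic algorithm common to all modules, it computes its movement: it stays, it rotates by a quarter turn around a side-adjacent module, or it slides by $\ell\ge 1$ cells along a line of $\ell+1$ modules beside its track. The modules that guide a movement must not move simultaneously; a movement enters only empty cells of the field (a rotation passes through the cell side-adjacent to both its start and its destination that is not the pivot's cell); the cells entered by different modules are distinct; and, in each MRS, the modules that do not move must be connected, and the MRS must be connected after the movements. Theorem. There is one algorithm with visibility range $k=9$ that solves the merge problem for two MRSs of five modules each, not equipped with a global compass, in every such field and from every initial configuration in which each module observes all ten modules, in particular from every initial configuration within an $8\times 8$ square: for all orientations of the local coordinate systems, the movements obey the above rules at all times, and after finitely many steps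 the side-adjacency graph of all ten modules is connected and no module moves any more. -/

import Mathlib

namespace MRS

/-! ### The square grid, the field and its walls -/

/-- A cell of the square grid, given by its coordinates. -/
abbrev Cell := ℤ × ℤ

/-- Two cells are side-adjacent if they share a side. -/
def SideAdjacent (c d : Cell) : Prop := |c.1 - d.1| + |c.2 - d.2| = 1

/-- The cells of the rectangular field of width `w` and height `h`. -/
def InField (w h : ℕ) (c : Cell) : Prop :=
  0 ≤ c.1 ∧ c.1 < w ∧ 0 ≤ c.2 ∧ c.2 < h

/-- The wall cells: the ring of cells that surrounds the field
(the north, south, east and west wall, in this order). -/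
def IsWall (w h : ℕ) (c : Cell) : Prop :=
  (-1 ≤ c.1 ∧ c.1 ≤ w ∧ c.2 = h) ∨ (-1 ≤ c.1 ∧ c.1 ≤ w ∧ c.2 = -1) ∨
  (c.1 = w ∧ -1 ≤ c.2 ∧ c.2 ≤ h) ∨ (c.1 = -1 ∧ -1 ≤ c.2 ∧ c.2 ≤ h)

instance (w h : ℕ) : DecidablePred (IsWall w h) := fun c => by
  unfold IsWall; infer_instance

/-- The four directions of the grid: east, north, west, south (counterclockwise). Adding `1`
(modulo 4) to a direction turns it counterclockwise by a quarter turn. -/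
abbrev Direction := Fin 4

/-- The unit vector in a direction. -/
def Direction.vec : Direction → Cell := ![(1, 0), (0, 1), (-1, 0), (0, -1)]

/-- Rotation of a vector by `θ` counterclockwise quarter turns. -/
def rot (θ : Fin 4) (v : Cell) : Cell :=
  ![(v.1, v.2), (-v.2, v.1), (-v.1, -v.2), (v.2, -v.1)] θ

/-! ### Modules and configurations -/

/-- The ten modules: `(i, j)` is the `j`-th module of the `i`-th MRS. The names serve only to follow
the modules over time; they are not accessible to the modules. -/
abbrev Module := Fin 2 × Fin 5

/-- The cells occupied by the modules. -/
abbrev Config := Module → Cell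

/-- The side-adjacency graph of the ten modules. -/
def sideGraph (p : Config) : SimpleGraph Module where
  Adj a b := SideAdjacent (p a) (p b)
  symm := ⟨fun a b hab => by
    simpa only [SideAdjacent, abs_sub_comm (p a).1, abs_sub_comm (p a).2] using hab⟩
  loopless := ⟨fun a ha => by simp [SideAdjacent] at ha⟩

/-- The modules of `S` form a (nonempty) connected side-adjacency graph. -/
def ConnectedOn (p : Config) (S : Set Module) : Prop := ((sideGraph p).induce S).Connected

/-- The two MRSs have merged: the side-adjacency graph of all ten modules is connected. -/
def Merged (p : Config) : Prop := (sideGraph p).Connected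

/-- Two disjoint MRSs in the field, each of them connected. -/
structure IsConfiguration (w h : ℕ) (p : Config) : Prop where
  injective : Function.Injective p
  inField : ∀ m, InField w h (p m)
  connected : ∀ i : Fin 2, ConnectedOn p {m | m.1 = i}

/-- The offset `v` lies in the `k`-neighborhood of the origin. -/
def InRange (k : ℕ) (v : Cell) : Prop := |v.1| ≤ k ∧ |v.2| ≤ k

/-- With visibility range `k`, each module observes all ten modules. -/
def AllVisible (k : ℕ) (p : Config) : Prop := ∀ m m' : Module, InRange k (p m' - p m)

/-! ### Movements -/

/-- The movements of a module, in terms of directions of some coordinate system.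
* `rotate d ccw`: rotation by a quarter turn around the module on the side-adjacent cell in
  direction `d`, counterclockwise if `ccw` is true and clockwise otherwise;
* `slide d ℓ`: sliding by `ℓ` cells in direction `d`. -/
inductive Move
  | stay
  | rotate (d : Direction) (ccw : Bool)
  | slide (d : Direction) (ℓ : ℕ)

namespace Move

/-- A movement given in a coordinate system that is turned by `θ` quarter turns against the global
one, expressed in the global one. -/
def toGlobal (θ : Fin 4) : Move → Move
  | stay => stay
  | rotate d ccw => rotate (θ + d) ccw
  | slide d ℓ => slide (θ + d) ℓ

/-- The direction to which the module first leaves its cell in `rotate d ccw`. -/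
def rotationSide (d : Direction) (ccw : Bool) : Direction := if ccw then d + 3 else d + 1

/-- The trajectory of a movement that starts in `c`: the cells entered, without `c`. A rotation goes
through the cell that is side-adjacent to the start cell and to the destination (and does not
contain the pivot). -/
def trajectory (c : Cell) : Move → List Cell
  | stay => []
  | rotate d ccw =>
      [c + (rotationSide d ccw).vec, c + (rotationSide d ccw).vec + d.vec]
  | slide d ℓ => (List.range ℓ).map fun i => c + ((i : ℤ) + 1) • d.vec

/-- The destination of a movement that starts in `c`. -/
def dest (c : Cell) : Move → Cell
  | stay => c
  | rotate d ccw => c + (rotationSide d ccw).vec + d.vec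
  | slide d ℓ => c + (ℓ : ℤ) • d.vec

end Move

/-- Some module occupies `c` and does not move. -/
def StationaryAt (p : Config) (a : Module → Move) (c : Cell) : Prop :=
  ∃ m, p m = c ∧ a m = Move.stay

/-- The movement of module `m` is guided by modules that do not move simultaneously: a rotation by
the pivot, an `ℓ`-sliding (`ℓ ≥ 1`) by a line of modules beside its whole track. -/
def Guided (p : Config) (a : Module → Move) (m : Module) : Prop :=
  match a m with
  | .stay => True
  | .rotate d _ => StationaryAt p a (p m + d.vec)
  | .slide d ℓ => 1 ≤ ℓ ∧ ∃ e : Direction, (e = d + 1 ∨ e = d + 3) ∧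
      ∀ i : ℕ, i ≤ ℓ → StationaryAt p a (p m + (i : ℤ) • d.vec + e.vec)

/-- The configuration after the (global) movements `a` are performed simultaneously. -/
def step (p : Config) (a : Module → Move) : Config := fun m => (a m).dest (p m)

/-- The movements `a` can be performed simultaneously in the configuration `p`. -/
structure Legal (w h : ℕ) (p : Config) (a : Module → Move) : Prop where
  /-- Every movement is guided by stationary modules. -/
  guided : ∀ m, Guided p a m
  /-- Every movement goes through cells of the field only. -/
  inField : ∀ m, ∀ c ∈ (a m).trajectory (p m), InField w h c
  /-- Every movement goes through empty cells only. -/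
  empty : ∀ m, ∀ c ∈ (a m).trajectory (p m), ∀ m', p m' ≠ c
  /-- The trajectories do not overlap. -/
  noOverlap : ∀ m m', m ≠ m' →
    List.Disjoint ((a m).trajectory (p m)) ((a m').trajectory (p m'))
  /-- The modules of each MRS that do not move are connected. -/
  backbone : ∀ i : Fin 2, ConnectedOn p {m | m.1 = i ∧ a m = Move.stay}
  /-- Each MRS is connected after the movements. -/
  connected : ∀ i : Fin 2, ConnectedOn (step p a) {m | m.1 = i}

/-! ### Observations, algorithms and executions -/

/-- What a module sees in a cell. -/
inductive Content
  | empty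
  | occupied
  | wall

/-- The content of a cell. -/
def content (w h : ℕ) (p : Config) (c : Cell) : Content :=
  if ∃ m, p m = c then .occupied else if IsWall w h c then .wall else .empty

/-- An observation with visibility range `k`: the contents of the cells of the `k`-neighborhood,
indexed by local coordinates. -/
abbrev Observation (k : ℕ) := {v : Cell // InRange k v} → Content

/-- The observation of module `m`, whose local coordinate system has its origin at the cell of `m`
and is turned by `θ` quarter turns against the global one. -/
def observe (k w h : ℕ) (p : Config) (θ : Fin 4) (m : Module) : Observation k :=
  fun v => content w h p (p m + rot θ v.1)

/-- A deterministic algorithm for uniform, anonymous, oblivious modules with visibility range `k`: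
the movement, in local coordinates, depends on nothing but the current observation, in local
coordinates. -/
abbrev Algorithm (k : ℕ) := Observation k → Move

/-- The movements (in global coordinates) that the algorithm makes the modules perform in the
configuration `p`, when the local coordinate systems are turned by `θ`. -/
def Algorithm.moves {k : ℕ} (A : Algorithm k) (w h : ℕ) (p : Config) (θ : Module → Fin 4) :
    Module → Move :=
  fun m => (A (observe k w h p (θ m) m)).toGlobal (θ m)

/-- The synchronous execution of the algorithm from the configuration `p`, where `θ t m` is the
orientation of the local coordinate system of module `m` at time `t`. -/
def Algorithm.execution {k : ℕ} (A : Algorithm k) (w h : ℕ) (p : Config)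
    (θ : ℕ → Module → Fin 4) : ℕ → Config
  | 0 => p
  | t + 1 => step (A.execution w h p θ t) (A.moves w h (A.execution w h p θ t) (θ t))

/-- The algorithm solves the merge problem from the configuration `p` without a global compass:
for all orientations of the local coordinate systems, the movements are legal at all times, and
in finite time a merged configuration is reached after which no module moves. -/
def Algorithm.SolvesMergeFrom {k : ℕ} (A : Algorithm k) (w h : ℕ) (p : Config) : Prop :=
  ∀ θ : ℕ → Module → Fin 4,
    (∀ t, Legal w h (A.execution w h p θ t) (A.moves w h (A.execution w h p θ t) (θ t))) ∧
    ∃ T, Merged (A.execution w h p θ T) ∧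
      ∀ t, T ≤ t → ∀ m, A.moves w h (A.execution w h p θ t) (θ t) m = Move.stay

end MRS

/-!
The ten modules see each other, so every module knows the configuration up to a similarity, that is,
up to a rotation, a translation and a renaming of the modules. Since unmerged MRSs are the connected
components of the side-adjacency graph, it also knows which modules belong together. A deterministic
algorithm is thus the same as a policy that commutes with similarities. Such a policy is obtained by
choosing movements in one position of each similarity class (`exists_policy`), and the choice is
constrained only by the symmetries of the position itself (`Equivariant`). It remains to show that
every position can be won by movements that respect its symmetries (`winnable_of_compact`); the
number of steps still needed then decreases under the policy until the MRSs have merged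
(`exists_algorithm_of_winnable`).

As long as the MRSs have not merged, they do not obstruct each other: a rotation or a slide by one
cell enters only cells next to modules of the moving MRS, and these cannot be occupied by the other
MRS (`legalIn_of_canMove`). The movements below are confined to the bounding box of the modules, with
one exception, so that they stay in the field and all modules keep seeing each other.

* A configuration without symmetries is won by moving one MRS only, one module at a time
  (`Approaches`). Some module `q` of the other MRS does not lie in a common row or column with the
  whole moving MRS, since otherwise all ten modules would fill a line without gaps
  (`exists_notCollinear`). The sum of the squared distances from `q` can then be lowered in one or two
  movements until a module arrives next to `q`.
* The only possible symmetry of an unmerged configuration is a point reflection that exchanges the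
  MRSs, since each MRS has an odd number of modules (`Similar.two_of_ne_zero`, `Similar.fst_ne`).
  Then both MRSs move symmetrically, and the sum of the squared distances from the center decreases
  (`SymmetricallyApproaches`). Here the modules may leave the bounding box by one cell in a dimension
  in which it is at most three cells thick. If the walls are touched symmetrically there, none of them
  is touched, because the field is at least four cells wide (`NearHull.field_mem`).
* If just one of two opposite walls of such a thin configuration is touched, the walls break the
  symmetry: one MRS keeps touching the wall, and the other one moves alone within the bounding box, so
  that the asymmetry persists until the MRSs merge (`winnable_of_touching`).

That the potentials can be lowered is a statement on the 63 fixed pentominoes and finitely many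
positions of `q` or of the center. It is verified by evaluation in the kernel
(`NatCell.allApproachable_eq_true`, `NatCell.allSymmetricallyApproachable_eq_true`).
-/

namespace MRS

/-! ### Rotations of the grid -/

theorem rot_add (θ : Fin 4) (u v : Cell) : rot θ (u + v) = rot θ u + rot θ v := by
  fin_cases θ <;> simp [rot, Prod.ext_iff] <;> omega

theorem rot_neg (θ : Fin 4) (u : Cell) : rot θ (-u) = -rot θ u := by
  fin_cases θ <;> simp [rot, Prod.ext_iff]

theorem rot_sub (θ : Fin 4) (u v : Cell) : rot θ (u - v) = rot θ u - rot θ v := by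
  rw [sub_eq_add_neg, rot_add, rot_neg, ← sub_eq_add_neg]

theorem rot_zsmul (θ : Fin 4) (k : ℤ) (u : Cell) : rot θ (k • u) = k • rot θ u := by
  fin_cases θ <;> simp [rot, Prod.ext_iff]

theorem rot_rot (θ θ' : Fin 4) (u : Cell) : rot θ (rot θ' u) = rot (θ + θ') u := by
  fin_cases θ <;> fin_cases θ' <;> simp [rot]

theorem rot_zero (u : Cell) : rot 0 u = u := by simp [rot]

theorem rot_two (u : Cell) : rot 2 u = -u := by simp [rot, Prod.ext_iff]

theorem rot_neg_rot (θ : Fin 4) (u : Cell) : rot (-θ) (rot θ u) = u := by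
  rw [rot_rot, neg_add_cancel, rot_zero]

theorem rot_rot_neg (θ : Fin 4) (u : Cell) : rot θ (rot (-θ) u) = u := by
  rw [rot_rot, add_neg_cancel, rot_zero]

theorem rot_injective (θ : Fin 4) : Function.Injective (rot θ) :=
  Function.LeftInverse.injective (rot_neg_rot θ)

theorem rot_vec (θ : Fin 4) (d : Direction) : rot θ d.vec = Direction.vec (θ + d) := by
  fin_cases θ <;> fin_cases d <;> simp [rot, Direction.vec]

theorem vec_add_two (d : Direction) : Direction.vec (d + 2) = -d.vec := by
  fin_cases d <;> simp [Direction.vec]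

/-- The inner product of two vectors of the grid. -/
def dot (u v : Cell) : ℤ := u.1 * v.1 + u.2 * v.2

theorem dot_add_left (u v w : Cell) : dot (u + v) w = dot u w + dot v w := by
  simp [dot]; ring

theorem dot_sub_left (u v w : Cell) : dot (u - v) w = dot u w - dot v w := by
  simp [dot]; ring

theorem dot_neg_right (u v : Cell) : dot u (-v) = -dot u v := by
  simp [dot]; ring

theorem dot_rot (θ : Fin 4) (u v : Cell) : dot (rot θ u) (rot θ v) = dot u v := by
  fin_cases θ <;> simp [rot, dot] <;> ring

theorem dot_rot_vec (θ : Fin 4) (u : Cell) (d : Direction) :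
    dot (rot θ u) (Direction.vec (θ + d)) = dot u d.vec := by
  rw [← rot_vec, dot_rot]

theorem dot_vec_self (d : Direction) : dot d.vec d.vec = 1 := by
  fin_cases d <;> simp [dot, Direction.vec]

/-- In terms of inner products with the four directions, a vector lies in the `k`-neighborhood of
the origin if all of them are at most `k`. -/
theorem inRange_iff_dot {k : ℕ} {v : Cell} : InRange k v ↔ ∀ d : Direction, dot v d.vec ≤ k := by
  simp only [InRange, abs_le, Fin.forall_fin_succ, dot, Direction.vec]
  simp
  constructor
  · rintro ⟨⟨_, _⟩, _, _⟩
    refine ⟨?_, ?_, ?_, ?_⟩ <;> linarith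
  · rintro ⟨_, _, _, _⟩
    refine ⟨⟨?_, ?_⟩, ?_, ?_⟩ <;> linarith

theorem sideAdjacent_iff_exists_vec {c d : Cell} :
    SideAdjacent c d ↔ ∃ e : Direction, d = c + e.vec := by
  simp only [SideAdjacent, Fin.exists_fin_succ, Direction.vec, Prod.ext_iff]
  simp
  rcases abs_cases (c.1 - d.1) with ⟨h, _⟩ | ⟨h, _⟩ <;>
    rcases abs_cases (c.2 - d.2) with ⟨h', _⟩ | ⟨h', _⟩ <;> rw [h, h'] <;> omega

theorem sideAdjacent_add_vec (c : Cell) (d : Direction) : SideAdjacent c (c + d.vec) :=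
  sideAdjacent_iff_exists_vec.2 ⟨d, rfl⟩

theorem SideAdjacent.symm {c d : Cell} (h : SideAdjacent c d) : SideAdjacent d c := by
  simpa only [SideAdjacent, abs_sub_comm] using h

theorem SideAdjacent.map_rot {c d : Cell} (h : SideAdjacent c d) (θ : Fin 4) (t : Cell) :
    SideAdjacent (rot θ c + t) (rot θ d + t) := by
  obtain ⟨e, rfl⟩ := sideAdjacent_iff_exists_vec.1 h
  refine sideAdjacent_iff_exists_vec.2 ⟨θ + e, ?_⟩
  rw [rot_add, rot_vec]; abel

theorem sideAdjacent_rot_iff {c d : Cell} (θ : Fin 4) (t : Cell) :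
    SideAdjacent (rot θ c + t) (rot θ d + t) ↔ SideAdjacent c d := by
  refine ⟨fun h => ?_, fun h => h.map_rot θ t⟩
  have := h.map_rot (-θ) (-rot (-θ) t)
  simpa [rot_add, rot_neg_rot] using this

/-! ### Movements in a rotated frame -/

namespace Move

theorem rotationSide_add (θ d : Direction) (ccw : Bool) :
    rotationSide (θ + d) ccw = θ + rotationSide d ccw := by
  cases ccw <;> simp [rotationSide, add_assoc]

theorem trajectory_toGlobal (θ : Fin 4) (t c : Cell) (v : Move) :
    (v.toGlobal θ).trajectory (rot θ c + t) =
      (v.trajectory c).map fun x => rot θ x + t := by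
  cases v with
  | stay => rfl
  | rotate d ccw =>
    simp only [toGlobal, trajectory, rotationSide_add, List.map_cons, List.map_nil, rot_add, rot_vec]
    congr 1
    · abel
    · congr 1; abel
  | slide d l =>
    simp only [toGlobal, trajectory, List.map_map]
    refine List.map_congr_left fun i _ => ?_
    simp only [Function.comp, rot_add, rot_zsmul, rot_vec]; abel

theorem dest_toGlobal (θ : Fin 4) (t c : Cell) (v : Move) :
    (v.toGlobal θ).dest (rot θ c + t) = rot θ (v.dest c) + t := by
  cases v with
  | stay => rfl
  | rotate d ccw => simp only [toGlobal, dest, rotationSide_add, rot_add, rot_vec]; abel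
  | slide d l => simp only [toGlobal, dest, rot_add, rot_zsmul, rot_vec]; abel

theorem trajectory_slide (c : Cell) (d : Direction) (l : ℕ) :
    (slide d l).trajectory c = (List.range l).map fun i : ℕ => c + ((i : ℤ) + 1) • d.vec := by
  simp [trajectory, ← List.map_eq_flatMap, Function.comp_def]

theorem toGlobal_toGlobal (θ θ' : Fin 4) (v : Move) :
    (v.toGlobal θ').toGlobal θ = v.toGlobal (θ + θ') := by
  cases v <;> simp [toGlobal, add_assoc]

theorem toGlobal_zero (v : Move) : v.toGlobal 0 = v := by
  cases v <;> simp [toGlobal]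

theorem toGlobal_eq_stay {θ : Fin 4} {v : Move} : v.toGlobal θ = stay ↔ v = stay := by
  cases v <;> simp [toGlobal]

end Move

/-! ### Connected sets of modules -/

theorem connectedOn_univ_iff {p : Config} : ConnectedOn p Set.univ ↔ Merged p :=
  (SimpleGraph.induceUnivIso (sideGraph p)).connected_iff

theorem connected_induce_union {p : Config} {S T : Set Module}
    (hS : ((sideGraph p).induce S).Connected) (hT : ((sideGraph p).induce T).Connected)
    (hST : (S ∩ T).Nonempty) : ConnectedOn p (S ∪ T) := by
  exact SimpleGraph.induce_union_connected hS.preconnected hT.preconnected hST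

theorem ConnectedOn.insert {p : Config} {S : Set Module} (h : ConnectedOn p S) {m m' : Module}
    (hm' : m' ∈ S) (hadj : SideAdjacent (p m) (p m')) : ConnectedOn p (insert m S) := by
  have h2 : ((sideGraph p).induce ({m, m'} : Set Module)).Connected :=
    SimpleGraph.induce_pair_connected_of_adj (G := sideGraph p) hadj
  have := connected_induce_union h2 h ⟨m', by simp, hm'⟩
  have e : ({m, m'} : Set Module) ∪ S = Insert.insert m S := by
    ext x; simp only [Set.mem_union, Set.mem_insert_iff, Set.mem_singleton_iff]
    constructor
    · rintro ((rfl | rfl) | h)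
      · exact Or.inl rfl
      · exact Or.inr hm'
      · exact Or.inr h
    · tauto
  rwa [e] at this

theorem ConnectedOn.union_of_sideAdjacent {p : Config} {S T : Set Module} (hS : ConnectedOn p S)
    (hT : ConnectedOn p T) {m m' : Module} (hm : m ∈ S) (hm' : m' ∈ T)
    (hadj : SideAdjacent (p m) (p m')) : ConnectedOn p (S ∪ T) := by
  have := connected_induce_union (hS.insert hm hadj.symm) hT ⟨m', by simp, hm'⟩
  rwa [Set.insert_union, Set.insert_eq_of_mem (show m' ∈ S ∪ T from Or.inr hm')] at this

theorem ConnectedOn.congr {p p' : Config} {S : Set Module} (h : ConnectedOn p S)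
    (hp : ∀ m ∈ S, p' m = p m) : ConnectedOn p' S := by
  have : (sideGraph p').induce S = (sideGraph p).induce S := by
    ext a b
    simp [sideGraph, hp a a.2, hp b b.2]
  unfold ConnectedOn
  rw [this]; exact h

/-! ### Similar configurations -/

/-- `p'` arises from `p` by a rotation by `θ` quarter turns, a translation by `t` and a renaming `σ`
of the modules that respects the partition into the two MRSs. -/
structure Similar (θ : Fin 4) (t : Cell) (σ : Equiv.Perm Module) (p p' : Config) : Prop where
  apply_eq : ∀ m, p' m = rot θ (p (σ m)) + t
  fst_eq_iff : ∀ m m', (σ m).1 = (σ m').1 ↔ m.1 = m'.1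

namespace Similar

variable {θ θ' : Fin 4} {t t' : Cell} {σ σ' : Equiv.Perm Module} {p p' p'' : Config}

theorem refl (p : Config) : Similar 0 0 1 p p :=
  ⟨fun m => by simp [rot_zero], fun m m' => Iff.rfl⟩

theorem trans (h : Similar θ t σ p p') (h' : Similar θ' t' σ' p' p'') :
    Similar (θ' + θ) (rot θ' t + t') (σ * σ') p p'' := by
  refine ⟨fun m => ?_, fun m m' => ?_⟩
  · rw [h'.apply_eq, h.apply_eq, rot_add, rot_rot, add_assoc, Equiv.Perm.mul_apply]
  · simp only [Equiv.Perm.mul_apply, h.fst_eq_iff, h'.fst_eq_iff]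

theorem symm (h : Similar θ t σ p p') : Similar (-θ) (-rot (-θ) t) σ⁻¹ p' p := by
  refine ⟨fun m => ?_, fun m m' => ?_⟩
  · rw [h.apply_eq, rot_add, rot_neg_rot]; simp
  · rw [← h.fst_eq_iff]; simp

theorem connectedOn_iff (h : Similar θ t σ p p') (S : Set Module) :
    ConnectedOn p' (σ ⁻¹' S) ↔ ConnectedOn p S := by
  let e : (sideGraph p').induce (σ ⁻¹' S) ≃g (sideGraph p).induce S :=
    { toEquiv := σ.subtypeEquiv fun _ => Iff.rfl
      map_rel_iff' := by
        intro a b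
        simp [sideGraph, h.apply_eq, sideAdjacent_rot_iff] }
  exact e.connected_iff

theorem merged_iff (h : Similar θ t σ p p') : Merged p' ↔ Merged p := by
  rw [← connectedOn_univ_iff, ← connectedOn_univ_iff, ← h.connectedOn_iff Set.univ, Set.preimage_univ]

theorem fst_eq_iff_fst_symm (h : Similar θ t σ p p') (i : Fin 2) (m : Module) :
    (σ m).1 = (σ (i, 0)).1 ↔ m.1 = i := h.fst_eq_iff m (i, 0)

theorem injective (h : Similar θ t σ p p') (hp : Function.Injective p) : Function.Injective p' := by
  intro m m' e
  rw [h.apply_eq, h.apply_eq] at e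
  exact σ.injective (hp (rot_injective θ (add_right_cancel e)))

theorem sub_eq (h : Similar θ t σ p p') (m m' : Module) :
    p' m - p' m' = rot θ (p (σ m) - p (σ m')) := by
  rw [h.apply_eq, h.apply_eq, rot_sub]; abel

/-- The translation and the renaming are determined by the rotation: a similarity of an injective
configuration with itself without rotation is trivial. -/
theorem eq_one_of_zero (h : Similar 0 t σ p p) (hp : Function.Injective p) : t = 0 ∧ σ = 1 := by
  have ht : t = 0 := by
    have h1 : ∑ m, p m = ∑ m, (p (σ m) + t) :=
      Finset.sum_congr rfl fun m _ => by rw [h.apply_eq m, rot_zero]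
    rw [Finset.sum_add_distrib, Equiv.sum_comp σ p, left_eq_add] at h1
    simpa [Prod.ext_iff] using h1
  subst ht
  refine ⟨rfl, Equiv.ext fun m => hp ?_⟩
  have := h.apply_eq m
  rw [rot_zero, add_zero] at this
  exact this.symm

end Similar

/-- The movements `a`, carried over along a similarity. -/
def transport (θ : Fin 4) (σ : Equiv.Perm Module) (a : Module → Move) : Module → Move :=
  fun m => (a (σ m)).toGlobal θ

theorem Similar.step {θ : Fin 4} {t : Cell} {σ : Equiv.Perm Module} {p p' : Config}
    (h : Similar θ t σ p p') (a : Module → Move) :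
    Similar θ t σ (MRS.step p a) (MRS.step p' (transport θ σ a)) := by
  refine ⟨fun m => ?_, h.fst_eq_iff⟩
  simp only [MRS.step, transport]
  rw [h.apply_eq, Move.dest_toGlobal]

/-! ### Rectangular fields and legal movements in them -/

/-- `F` is the set of cells of a rectangular field, at least four cells wide and high, in arbitrary
position. The number `b d` bounds the coordinate of the cells in direction `d`. -/
def IsField (F : Cell → Prop) : Prop :=
  ∃ b : Direction → ℤ, (∀ d, 3 ≤ b d + b (d + 2)) ∧ ∀ c, F c ↔ ∀ d, dot c d.vec ≤ b d

/-- The movements `a` can be performed simultaneously in the configuration `p` in the field `F`. -/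
structure LegalIn (F : Cell → Prop) (p : Config) (a : Module → Move) : Prop where
  guided : ∀ m, Guided p a m
  inField : ∀ m, ∀ c ∈ (a m).trajectory (p m), F c
  empty : ∀ m, ∀ c ∈ (a m).trajectory (p m), ∀ m', p m' ≠ c
  noOverlap : ∀ m m', m ≠ m' →
    List.Disjoint ((a m).trajectory (p m)) ((a m').trajectory (p m'))
  backbone : ∀ i : Fin 2, ConnectedOn p {m | m.1 = i ∧ a m = Move.stay}
  connected : ∀ i : Fin 2, ConnectedOn (step p a) {m | m.1 = i}

/-- The modules lie within three consecutive lines orthogonal to `d`. -/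
def Thin (p : Config) (d : Direction) : Prop := ∀ m m', dot (p m - p m') d.vec ≤ 2

/-- The information on the walls that the algorithm uses: whether some module touches the wall in
direction `d`, provided that the modules lie within three consecutive lines orthogonal to `d`. -/
def touching (F : Cell → Prop) (p : Config) (d : Direction) : Prop :=
  (∃ m, ¬ F (p m + d.vec)) ∧ Thin p d

section transport

variable {θ : Fin 4} {t : Cell} {σ : Equiv.Perm Module} {p p' : Config}

theorem IsField.comap {F : Cell → Prop} (hF : IsField F) (θ : Fin 4) (t : Cell) :
    IsField fun c => F (rot θ c + t) := by
  obtain ⟨b, hb, hF⟩ := hF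
  refine ⟨fun d => b (θ + d) - dot t (Direction.vec (θ + d)), fun d => ?_, fun c => ?_⟩
  · have := hb (θ + d)
    simp only [← add_assoc, vec_add_two, dot_neg_right] at this ⊢
    linarith
  · refine (hF _).trans ?_
    constructor
    · intro h d
      have := h (θ + d)
      rw [dot_add_left, dot_rot_vec] at this
      linarith
    · intro h d
      have := h (-θ + d)
      simp only [add_neg_cancel_left] at this
      rw [dot_add_left, ← add_neg_cancel_left θ d, dot_rot_vec, add_neg_cancel_left]
      linarith

theorem Similar.thin_iff (h : Similar θ t σ p p') (d : Direction) :
    Thin p' (θ + d) ↔ Thin p d := by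
  simp only [Thin, h.sub_eq, dot_rot_vec]
  exact ⟨fun H m m' => by simpa using H (σ⁻¹ m) (σ⁻¹ m'), fun H m m' => H _ _⟩

theorem Similar.touching_iff (h : Similar θ t σ p p') (F : Cell → Prop) (d : Direction) :
    touching F p' (θ + d) ↔ touching (fun c => F (rot θ c + t)) p d := by
  refine and_congr ?_ (h.thin_iff d)
  have : ∀ m, p' m + Direction.vec (θ + d) = rot θ (p (σ m) + d.vec) + t := fun m => by
    rw [h.apply_eq, rot_add, rot_vec]; abel
  simp only [this]
  exact ⟨fun ⟨m, hm⟩ => ⟨_, hm⟩, fun ⟨m, hm⟩ => ⟨σ⁻¹ m, by simpa using hm⟩⟩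

theorem Similar.stationaryAt_iff (h : Similar θ t σ p p') (a : Module → Move) (c : Cell) :
    StationaryAt p' (transport θ σ a) (rot θ c + t) ↔ StationaryAt p a c := by
  simp only [StationaryAt, transport, Move.toGlobal_eq_stay, h.apply_eq]
  constructor
  · rintro ⟨m, hm, ha⟩
    exact ⟨σ m, rot_injective θ (add_right_cancel hm), ha⟩
  · rintro ⟨m, rfl, ha⟩
    exact ⟨σ⁻¹ m, by simp, by simpa using ha⟩

theorem Similar.guided_iff (h : Similar θ t σ p p') (a : Module → Move) (m : Module) :
    Guided p' (transport θ σ a) m ↔ Guided p a (σ m) := by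
  unfold Guided
  cases ha : a (σ m) with
  | stay => simp [transport, ha, Move.toGlobal]
  | rotate d ccw =>
    simp only [transport, ha, Move.toGlobal]
    rw [← h.stationaryAt_iff a, h.apply_eq, rot_add, rot_vec, add_right_comm]
  | slide d l =>
    simp only [transport, ha, Move.toGlobal]
    refine and_congr_right fun _ => ?_
    have key : ∀ (e : Direction) (i : ℕ),
        StationaryAt p' (transport θ σ a)
          (p' m + (i : ℤ) • Direction.vec (θ + d) + Direction.vec (θ + e)) ↔
        StationaryAt p a (p (σ m) + (i : ℤ) • d.vec + e.vec) := fun e i => by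
      rw [← h.stationaryAt_iff a, h.apply_eq, rot_add, rot_add, rot_zsmul, rot_vec, rot_vec]
      rw [show ∀ x y z w : Cell, x + w + y + z = x + y + z + w from fun x y z w => by abel]
    constructor
    · rintro ⟨e, he, H⟩
      refine ⟨-θ + e, ?_, fun i hi => (key _ i).1 ?_⟩
      · rcases he with rfl | rfl
        · left; abel
        · right; abel
      · rw [add_neg_cancel_left]; exact H i hi
    · rintro ⟨e, he, H⟩
      refine ⟨θ + e, ?_, fun i hi => (key e i).2 (H i hi)⟩
      rcases he with rfl | rfl
      · left; abel
      · right; abel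

theorem Similar.trajectory (h : Similar θ t σ p p') (a : Module → Move) (m : Module) :
    (transport θ σ a m).trajectory (p' m) =
      ((a (σ m)).trajectory (p (σ m))).map fun x => rot θ x + t := by
  rw [h.apply_eq, transport, Move.trajectory_toGlobal]

theorem Similar.legalIn {F : Cell → Prop} {a : Module → Move} (h : Similar θ t σ p p')
    (ha : LegalIn (fun c => F (rot θ c + t)) p a) : LegalIn F p' (transport θ σ a) where
  guided m := (h.guided_iff a m).2 (ha.guided _)
  inField m c hc := by
    rw [h.trajectory, List.mem_map] at hc
    obtain ⟨x, hx, rfl⟩ := hc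
    exact ha.inField _ x hx
  empty m c hc m' e := by
    rw [h.trajectory, List.mem_map] at hc
    obtain ⟨x, hx, rfl⟩ := hc
    rw [h.apply_eq] at e
    exact ha.empty _ x hx _ (rot_injective θ (add_right_cancel e))
  noOverlap m m' hm := by
    intro c hc hc'
    rw [h.trajectory, List.mem_map] at hc hc'
    obtain ⟨x, hx, rfl⟩ := hc
    obtain ⟨y, hy, e⟩ := hc'
    cases rot_injective θ (add_right_cancel e)
    exact ha.noOverlap _ _ (σ.injective.ne hm) hx hy
  backbone i := by
    refine (Eq.mp ?_ ((h.connectedOn_iff _).2 (ha.backbone (σ (i, 0)).1)))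
    congr 1
    ext m
    simp [transport, Move.toGlobal_eq_stay, h.fst_eq_iff_fst_symm]
  connected i := by
    refine (Eq.mp ?_ (((h.step a).connectedOn_iff _).2 (ha.connected (σ (i, 0)).1)))
    congr 1
    ext m
    simp [h.fst_eq_iff_fst_symm]

end transport

/-! ### Winning positions of the merge game -/

section game

variable {θ θ' : Fin 4} {t t' : Cell} {σ σ' : Equiv.Perm Module} {p p' : Config}
  {f f' : Direction → Prop} {a : Module → Move}

theorem transport_transport (θ θ' : Fin 4) (σ σ' : Equiv.Perm Module) (a : Module → Move) :
    transport θ' σ' (transport θ σ a) = transport (θ' + θ) (σ * σ') a := by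
  funext m; simp [transport, Move.toGlobal_toGlobal]

theorem transport_zero_one (a : Module → Move) : transport 0 1 a = a := by
  funext m; simp [transport, Move.toGlobal_zero]

/-- The movements `a` are compatible with all symmetries of the configuration `p` that preserve the
information `f` on the walls. Only such movements can be prescribed to modules without a compass. -/
def Equivariant (p : Config) (f : Direction → Prop) (a : Module → Move) : Prop :=
  ∀ θ t σ, Similar θ t σ p p → (∀ d, f (θ + d) ↔ f d) → transport θ σ a = a

theorem Equivariant.similar (h : Similar θ t σ p p') (hf : ∀ d, f' (θ + d) ↔ f d)
    (ha : Equivariant p f a) : Equivariant p' f' (transport θ σ a) := by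
  intro θ₁ t₁ σ₁ h₁ hf₁
  have key := ha _ _ _ ((h.trans h₁).trans h.symm) fun d => by
    rw [← hf, show θ + (-θ + (θ₁ + θ) + d) = θ₁ + (θ + d) by abel, hf₁, hf]
  conv_rhs => rw [← key]
  rw [transport_transport, transport_transport]
  congr 1
  · abel
  · group

/-- The position with configuration `p` and wall information `f` is won within `n` steps: there are
`Equivariant` movements that are legal in every field that agrees with the information `f`, keep
the modules within sight of each other, and lead to positions won within `n - 1` steps. -/
def Winning : ℕ → Config → (Direction → Prop) → Prop
  | 0, p, _ => Merged p
  | n + 1, p, f => Merged p ∨ ∃ a, Equivariant p f a ∧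
      ∀ F, IsField F → (∀ m, F (p m)) → touching F p = f →
        LegalIn F p a ∧ AllVisible 9 (step p a) ∧ Winning n (step p a) (touching F (step p a))

theorem Similar.allVisible_iff (h : Similar θ t σ p p') (k : ℕ) :
    AllVisible k p' ↔ AllVisible k p := by
  simp only [AllVisible, inRange_iff_dot, h.sub_eq]
  constructor
  · intro H m m' d
    have := H (σ⁻¹ m) (σ⁻¹ m') (θ + d)
    simpa [dot_rot_vec] using this
  · intro H m m' d
    have := H (σ m) (σ m') (-θ + d)
    rw [← dot_rot_vec θ, add_neg_cancel_left] at this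
    exact this

theorem Similar.field_mem (h : Similar θ t σ p p') {F : Cell → Prop} (hF : ∀ m, F (p' m))
    (m : Module) : F (rot θ (p m) + t) := by
  have := hF (σ⁻¹ m)
  rw [h.apply_eq] at this
  simpa using this

theorem Similar.touching_comap_eq (h : Similar θ t σ p p') (hf : ∀ d, f' (θ + d) ↔ f d)
    {F : Cell → Prop} (hF : touching F p' = f') : touching (fun c => F (rot θ c + t)) p = f := by
  funext d
  rw [← h.touching_iff, hF, hf]

theorem Winning.similar {n : ℕ} (h : Similar θ t σ p p') (hf : ∀ d, f' (θ + d) ↔ f d)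
    (hw : Winning n p f) : Winning n p' f' := by
  induction n generalizing p p' f f' with
  | zero => exact h.merged_iff.2 hw
  | succ n ih =>
    rcases hw with hw | ⟨a, ha, hw⟩
    · exact Or.inl (h.merged_iff.2 hw)
    · refine Or.inr ⟨transport θ σ a, ha.similar h hf, fun F hF hp hfF => ?_⟩
      obtain ⟨h1, h2, h3⟩ := hw _ (hF.comap θ t) (h.field_mem hp) (h.touching_comap_eq hf hfF)
      exact ⟨h.legalIn h1, ((h.step a).allVisible_iff 9).2 h2,
        ih (h.step a) ((h.step a).touching_iff F) h3⟩

theorem Winning.succ {n : ℕ} (hw : Winning n p f) : Winning (n + 1) p f := by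
  induction n generalizing p f with
  | zero => exact Or.inl hw
  | succ n ih =>
    rcases hw with hw | ⟨a, ha, hw⟩
    · exact Or.inl hw
    · exact Or.inr ⟨a, ha, fun F hF hp hfF =>
        ⟨(hw F hF hp hfF).1, (hw F hF hp hfF).2.1, ih (hw F hF hp hfF).2.2⟩⟩

theorem Winning.mono {n k : ℕ} (hnk : n ≤ k) (hw : Winning n p f) : Winning k p f := by
  induction hnk with
  | refl => exact hw
  | step _ ih => exact ih.succ

/-- The position is won within finitely many steps. -/
def Winnable (p : Config) (f : Direction → Prop) : Prop := ∃ n, Winning n p f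

theorem Merged.winnable (h : Merged p) (f : Direction → Prop) : Winnable p f := ⟨0, h⟩

theorem Winnable.similar (h : Similar θ t σ p p') (hf : ∀ d, f' (θ + d) ↔ f d)
    (hw : Winnable p f) : Winnable p' f' := hw.imp fun _ hn => hn.similar h hf

/-- The number of steps is bounded uniformly, since there are finitely many possible
informations on the walls after the step. -/
theorem Winnable.of_step (ha : Equivariant p f a)
    (hw : ∀ F, IsField F → (∀ m, F (p m)) → touching F p = f →
      LegalIn F p a ∧ AllVisible 9 (step p a) ∧ Winnable (step p a) (touching F (step p a))) :
    Winnable p f := by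
  classical
  have key : ∀ f' : Direction → Prop, ∃ n, Winnable (step p a) f' → Winning n (step p a) f' := by
    intro f'
    by_cases h : Winnable (step p a) f'
    · exact h.imp fun n hn _ => hn
    · exact ⟨0, fun h' => absurd h' h⟩
  choose N hN using key
  obtain ⟨B, hB⟩ := (Set.finite_range N).bddAbove
  refine ⟨B + 1, Or.inr ⟨a, ha, fun F hF hp hfF => ?_⟩⟩
  obtain ⟨h1, h2, h3⟩ := hw F hF hp hfF
  exact ⟨h1, h2, (hN _ h3).mono (hB ⟨_, rfl⟩)⟩

/-! ### An equivariant optimal policy -/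

/-- Equivariant movements that, in an unmerged position, lower the number of steps needed. -/
def IsOptimal (p : Config) (f : Direction → Prop) (a : Module → Move) : Prop :=
  Equivariant p f a ∧ (¬ Merged p → ∀ n, Winning n p f →
    ∀ F, IsField F → (∀ m, F (p m)) → touching F p = f →
      LegalIn F p a ∧ AllVisible 9 (step p a) ∧
        ∃ k < n, Winning k (step p a) (touching F (step p a)))

theorem exists_isOptimal (p : Config) (f : Direction → Prop) : ∃ a, IsOptimal p f a := by
  classical
  by_cases h : ∃ n, Winning n p f
  swap
  · exact ⟨fun _ => .stay, fun _ _ _ _ _ => rfl, fun _ n hn => absurd ⟨n, hn⟩ h⟩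
  by_cases hm : Merged p
  · exact ⟨fun _ => .stay, fun _ _ _ _ _ => rfl, fun h => absurd hm h⟩
  have hn := Nat.find_spec h
  obtain ⟨k, hk⟩ : ∃ k, Nat.find h = k + 1 :=
    Nat.exists_eq_succ_of_ne_zero fun h0 => hm (by rw [h0] at hn; exact hn)
  rw [hk] at hn
  rcases hn with hn | ⟨a, ha, hn⟩
  · exact absurd hn hm
  refine ⟨a, ha, fun _ n hw F hF hp hfF => ?_⟩
  obtain ⟨h1, h2, h3⟩ := hn F hF hp hfF
  exact ⟨h1, h2, k, by have := Nat.find_min' h hw; omega, h3⟩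

theorem IsOptimal.similar (h : Similar θ t σ p p') (hf : ∀ d, f' (θ + d) ↔ f d)
    (ha : IsOptimal p f a) : IsOptimal p' f' (transport θ σ a) := by
  refine ⟨ha.1.similar h hf, fun hm n hw F hF hp hfF => ?_⟩
  have hw' : Winning n p f := hw.similar h.symm fun d => by rw [← hf, add_neg_cancel_left]
  obtain ⟨h1, h2, k, hk, h3⟩ := ha.2 (fun hm' => hm (h.merged_iff.2 hm')) n hw' _ (hF.comap θ t)
    (h.field_mem hp) (h.touching_comap_eq hf hfF)
  exact ⟨h.legalIn h1, ((h.step a).allVisible_iff 9).2 h2, k, hk,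
    h3.similar (h.step a) ((h.step a).touching_iff F)⟩

/-- Positions that differ by a similarity. -/
def positionSetoid : Setoid (Config × (Direction → Prop)) where
  r v v' := ∃ θ t σ, Similar θ t σ v.1 v'.1 ∧ ∀ d, v'.2 (θ + d) ↔ v.2 d
  iseqv :=
    { refl := fun v => ⟨0, 0, 1, .refl _, fun d => by rw [zero_add]⟩
      symm := fun ⟨θ, t, σ, h, hf⟩ =>
        ⟨_, _, _, h.symm, fun d => by rw [← hf, add_neg_cancel_left]⟩
      trans := fun ⟨θ, t, σ, h, hf⟩ ⟨θ', t', σ', h', hf'⟩ =>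
        ⟨_, _, _, h.trans h', fun d => by rw [add_assoc, hf', hf]⟩ }

/-- Choosing optimal movements in one position of each similarity class and carrying them over to
the others gives a policy that commutes with similarities. -/
theorem exists_policy : ∃ π : Config → (Direction → Prop) → Module → Move,
    (∀ p f, IsOptimal p f (π p f)) ∧
    ∀ θ t σ p p' f f', Similar θ t σ p p' → (∀ d, f' (θ + d) ↔ f d) →
      π p' f' = transport θ σ (π p f) := by
  classical
  let rep : Config × (Direction → Prop) → Config × (Direction → Prop) :=
    fun v => (Quotient.mk positionSetoid v).out
  have hrep : ∀ v, ∃ θ t σ, Similar θ t σ (rep v).1 v.1 ∧ ∀ d, v.2 (θ + d) ↔ (rep v).2 d :=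
    fun v => Quotient.exact (s := positionSetoid) (Quotient.out_eq _)
  choose Θ T ρ hsim hflag using hrep
  choose act hact using fun v : Config × (Direction → Prop) => exists_isOptimal v.1 v.2
  refine ⟨fun p f => transport (Θ (p, f)) (ρ (p, f)) (act (rep (p, f))), fun p f => ?_, ?_⟩
  · exact (hact _).similar (hsim (p, f)) (hflag (p, f))
  · intro θ t σ p p' f f' h hf
    have e : rep (p', f') = rep (p, f) := by
      simp only [rep]
      congr 1
      exact (Quotient.sound (s := positionSetoid) ⟨θ, t, σ, h, hf⟩).symm
    have h1 := hsim (p', f')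
    have h1f := hflag (p', f')
    rw [e] at h1 h1f
    have h2 := (hsim (p, f)).trans h
    have key := (hact (rep (p, f))).1 _ _ _ (h2.trans h1.symm) fun d => by
      rw [← h1f, show Θ (p', f') + (-Θ (p', f') + (θ + Θ (p, f)) + d) = θ + (Θ (p, f) + d) by abel]
      exact (hf _).trans (hflag (p, f) d)
    simp only [e]
    conv_lhs => rw [← key]
    rw [transport_transport, transport_transport]
    congr 1
    · abel
    · group

end game

/-! ### Connectedness of the two MRSs and of the whole configuration -/

theorem fin_two_eq_of_ne {i j k : Fin 2} (h : i ≠ j) : k = i ∨ k = j := by omega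

/-- Two MRSs with side-adjacent modules have merged. -/
theorem merged_of_sideAdjacent {p : Config} (hp : ∀ i : Fin 2, ConnectedOn p {m | m.1 = i})
    {m m' : Module} (hm : m.1 ≠ m'.1) (h : SideAdjacent (p m) (p m')) : Merged p := by
  rw [← connectedOn_univ_iff]
  have := (hp m.1).union_of_sideAdjacent (hp m'.1) (m := m) (m' := m') rfl rfl h
  convert this
  ext x
  simpa using fin_two_eq_of_ne hm

/-- Two modules of different MRSs that are joined by a path force the two MRSs to have merged. -/
theorem merged_of_reachable {p : Config} (hp : ∀ i : Fin 2, ConnectedOn p {m | m.1 = i})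
    {m m' : Module} (hm : m.1 ≠ m'.1) (h : (sideGraph p).Reachable m m') : Merged p := by
  by_contra hmer
  obtain ⟨w⟩ := h
  induction w with
  | nil => exact hm rfl
  | @cons u v _ huv _ ih =>
    by_cases huv' : u.1 = v.1
    · exact ih (huv' ▸ hm)
    · exact hmer (merged_of_sideAdjacent hp huv' huv)

theorem reachable_of_fst_eq {p : Config} (hp : ∀ i : Fin 2, ConnectedOn p {m | m.1 = i})
    {m m' : Module} (h : m.1 = m'.1) : (sideGraph p).Reachable m m' :=
  ((hp m'.1).preconnected ⟨m, h⟩ ⟨m', rfl⟩).map (SimpleGraph.Embedding.induce _).toHom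

theorem fst_eq_iff_reachable {p : Config} (hp : ∀ i : Fin 2, ConnectedOn p {m | m.1 = i})
    (hmer : ¬ Merged p) {m m' : Module} : m.1 = m'.1 ↔ (sideGraph p).Reachable m m' :=
  ⟨reachable_of_fst_eq hp, fun h => by_contra fun hne => hmer (merged_of_reachable hp hne h)⟩

section

variable {θ : Fin 4} {t : Cell} {σ : Equiv.Perm Module} {p p' : Config}

/-- A renaming of the modules is an isomorphism of side-adjacency graphs. -/
def sideGraphIso (h : ∀ m, p' m = rot θ (p (σ m)) + t) : sideGraph p' ≃g sideGraph p where
  toEquiv := σ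
  map_rel_iff' := by
    intro a b
    simp [sideGraph, h, sideAdjacent_rot_iff]

/-- In unmerged configurations, the MRSs are recognizable as the connected components. -/
theorem Similar.of_not_merged (h : ∀ m, p' m = rot θ (p (σ m)) + t)
    (hp : ∀ i : Fin 2, ConnectedOn p {m | m.1 = i}) (hmer : ¬ Merged p)
    (hp' : ∀ i : Fin 2, ConnectedOn p' {m | m.1 = i}) : Similar θ t σ p p' := by
  have hmer' : ¬ Merged p' := fun H => hmer ((sideGraphIso h).connected_iff.1 H)
  refine ⟨h, fun m m' => ?_⟩
  rw [fst_eq_iff_reachable hp hmer, fst_eq_iff_reachable hp' hmer']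
  exact (sideGraphIso h).reachable_iff

end

/-! ### The algorithm -/

/-- The local cell `v` is seen to be occupied. -/
def SeesModule (o : Observation 9) (v : Cell) : Prop := ∃ h, o ⟨v, h⟩ = .occupied

/-- The information on the walls that is extracted from an observation. -/
def seesTouching (o : Observation 9) (d : Direction) : Prop :=
  (∃ v, SeesModule o v ∧ ∃ h, o ⟨v + d.vec, h⟩ = .wall) ∧
    ∀ v v', SeesModule o v → SeesModule o v' → dot (v - v') d.vec ≤ 2

/-- The unmerged configuration `q` explains the observation `o`. -/
structure Explains (o : Observation 9) (q : Config) : Prop where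
  injective : Function.Injective q
  connected : ∀ i : Fin 2, ConnectedOn q {m | m.1 = i}
  not_merged : ¬ Merged q
  sees_iff : ∀ v, SeesModule o v ↔ ∃ m, q m = v

open Classical in
/-- The algorithm: a module picks a configuration that explains its observation and follows the
policy `π` in the role of the module at the origin. If there is none, it stays. -/
noncomputable def mergeAlgorithm (π : Config → (Direction → Prop) → Module → Move) :
    Algorithm 9 := fun o =>
  if h : ∃ q : Config × Module, Explains o q.1 ∧ q.1 q.2 = 0 then
    π h.choose.1 (seesTouching o) h.choose.2
  else .stay

/-- A configuration in the field `F` in which all modules see each other. -/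
structure Valid (F : Cell → Prop) (p : Config) : Prop where
  injective : Function.Injective p
  connected : ∀ i : Fin 2, ConnectedOn p {m | m.1 = i}
  mem : ∀ m, F (p m)
  visible : AllVisible 9 p

theorem isField_inField {w h : ℕ} (hw : 4 ≤ w) (hh : 4 ≤ h) : IsField (InField w h) := by
  refine ⟨![w - 1, h - 1, 0, 0], ?_, fun c => ?_⟩
  · simp only [Fin.forall_fin_succ]
    simp
    omega
  · simp only [InField, Fin.forall_fin_succ, dot, Direction.vec]
    simp
    omega

theorem isWall_add_vec_iff {w h : ℕ} {c : Cell} (hc : InField w h c) (d : Direction) :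
    IsWall w h (c + d.vec) ↔ ¬ InField w h (c + d.vec) := by
  simp only [InField] at hc
  fin_cases d <;> simp [IsWall, InField, Direction.vec] <;> omega

section observation

variable {w h : ℕ} {p : Config} {θ : Fin 4} {m : Module}

theorem content_eq_occupied {c : Cell} : content w h p c = .occupied ↔ ∃ m, p m = c := by
  unfold content
  split_ifs <;> simp_all

theorem content_eq_wall {c : Cell} :
    content w h p c = .wall ↔ (¬ ∃ m, p m = c) ∧ IsWall w h c := by
  unfold content
  split_ifs <;> simp_all

theorem inRange_rot {k : ℕ} {v : Cell} (θ : Fin 4) (hv : InRange k v) : InRange k (rot θ v) := by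
  rw [inRange_iff_dot] at hv ⊢
  intro d
  have := hv (-θ + d)
  rwa [← dot_rot_vec θ, add_neg_cancel_left] at this

theorem seesModule_observe (hp : AllVisible 9 p) (v : Cell) :
    SeesModule (observe 9 w h p θ m) v ↔ ∃ m', p m' = p m + rot θ v := by
  simp only [SeesModule, observe, content_eq_occupied]
  refine ⟨fun ⟨_, h⟩ => h, fun ⟨m', h⟩ => ⟨?_, m', h⟩⟩
  have : v = rot (-θ) (p m' - p m) := by rw [h, add_sub_cancel_left, rot_neg_rot]
  rw [this]
  exact inRange_rot _ (hp m m')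

theorem seesTouching_observe (hp : Valid (InField w h) p) (d : Direction) :
    seesTouching (observe 9 w h p θ m) d ↔ touching (InField w h) p (θ + d) := by
  have hsee := seesModule_observe (w := w) (h := h) (θ := θ) (m := m) hp.visible
  have hcell : ∀ m', SeesModule (observe 9 w h p θ m) (rot (-θ) (p m' - p m)) := fun m' =>
    (hsee _).2 ⟨m', by rw [rot_rot_neg]; abel⟩
  have hthin : (∀ v v', SeesModule (observe 9 w h p θ m) v → SeesModule (observe 9 w h p θ m) v' →
      dot (v - v') d.vec ≤ 2) ↔ Thin p (θ + d) := by
    constructor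
    · intro H m₁ m₂
      have := H _ _ (hcell m₁) (hcell m₂)
      rwa [← rot_sub, ← dot_rot_vec θ, rot_rot_neg, sub_sub_sub_cancel_right] at this
    · intro H v v' hv hv'
      obtain ⟨m₁, h₁⟩ := (hsee v).1 hv
      obtain ⟨m₂, h₂⟩ := (hsee v').1 hv'
      have := H m₁ m₂
      rwa [h₁, h₂, add_sub_add_left_eq_sub, ← rot_sub, dot_rot_vec] at this
  unfold seesTouching touching
  rw [hthin]
  refine and_congr_left fun ht => ?_
  constructor
  · rintro ⟨v, hv, hr, ho⟩
    obtain ⟨m', hm'⟩ := (hsee v).1 hv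
    refine ⟨m', ?_⟩
    rw [observe, content_eq_wall, rot_add, rot_vec, ← add_assoc, ← hm',
      isWall_add_vec_iff (hp.mem m')] at ho
    exact ho.2
  · rintro ⟨m', hm'⟩
    refine ⟨_, hcell m', ?_, ?_⟩
    · rw [inRange_iff_dot]
      intro e
      have h1 : dot (rot (-θ) (p m' - p m)) d.vec ≤ 2 := by
        rw [← dot_rot_vec θ, rot_rot_neg]; exact ht m' m
      have h2 := inRange_iff_dot.1 (inRange_rot (-θ) (hp.visible m m'))
      have h3 := h2 e
      rw [dot_add_left]
      -- Only in direction `d` does the wall cell stick out, where the modules are close together.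
      by_cases hed : e = d
      · subst hed
        rw [dot_vec_self]; push_cast; linarith
      · have : dot d.vec e.vec ≤ 0 := by
          clear h1 h2 h3 hm' ht hthin
          revert d e
          simp only [dot, Direction.vec]
          decide
        linarith
    · rw [observe, content_eq_wall, rot_add, rot_vec, ← add_assoc, rot_rot_neg,
        add_sub_cancel, isWall_add_vec_iff (hp.mem m')]
      exact ⟨fun ⟨m'', h''⟩ => hm' (h'' ▸ hp.mem m''), hm'⟩

theorem exists_perm_of_explains (hp : Valid (InField w h) p) {q : Config}
    (hq : Explains (observe 9 w h p θ m) q) :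
    ∃ σ : Equiv.Perm Module, ∀ m', p m' = rot θ (q (σ m')) + p m := by
  have hsee := seesModule_observe (w := w) (h := h) (θ := θ) (m := m) hp.visible
  have : ∀ m', ∃ m'', q m'' = rot (-θ) (p m' - p m) := fun m' =>
    (hq.sees_iff _).1 ((hsee _).2 ⟨m', by rw [rot_rot_neg]; abel⟩)
  choose s hs using this
  have hinj : Function.Injective s := by
    intro m₁ m₂ e
    have : rot (-θ) (p m₁ - p m) = rot (-θ) (p m₂ - p m) := by rw [← hs, ← hs, e]
    exact hp.injective (sub_left_injective (rot_injective _ this))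
  refine ⟨Equiv.ofBijective s (Finite.injective_iff_bijective.1 hinj), fun m' => ?_⟩
  rw [Equiv.ofBijective_apply, hs, rot_rot_neg, sub_add_cancel]

theorem explains_observe (hp : Valid (InField w h) p) (hmer : ¬ Merged p) :
    Explains (observe 9 w h p θ m) fun m' => rot (-θ) (p m') + -rot (-θ) (p m) := by
  have hsim : Similar (-θ) (-rot (-θ) (p m)) 1 p
      fun m' => rot (-θ) (p m') + -rot (-θ) (p m) := ⟨fun _ => rfl, fun _ _ => Iff.rfl⟩
  refine ⟨hsim.injective hp.injective, fun i => ?_, fun H => hmer (hsim.merged_iff.1 H),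
    fun v => ?_⟩
  · exact (hsim.connectedOn_iff _).2 (hp.connected i)
  · rw [seesModule_observe hp.visible]
    refine exists_congr fun m' => ?_
    constructor
    · intro e; rw [e, rot_add, rot_neg_rot]; abel
    · intro e; rw [← e, rot_add, rot_neg, rot_rot_neg, rot_rot_neg]; abel

variable {π : Config → (Direction → Prop) → Module → Move}

theorem mergeAlgorithm_moves_of_merged (hp : Valid (InField w h) p) (hmer : Merged p)
    (θ : Module → Fin 4) (m : Module) : (mergeAlgorithm π).moves w h p θ m = .stay := by
  have : ¬ ∃ q : Config × Module, Explains (observe 9 w h p (θ m) m) q.1 ∧ q.1 q.2 = 0 := by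
    rintro ⟨⟨q, m₀⟩, hq, -⟩
    obtain ⟨σ, hσ⟩ := exists_perm_of_explains hp hq
    exact hq.not_merged ((sideGraphIso hσ).connected_iff.1 hmer)
  rw [Algorithm.moves, mergeAlgorithm, dif_neg this]
  rfl

theorem mergeAlgorithm_moves (hπ : ∀ θ t σ p p' f f', Similar θ t σ p p' →
      (∀ d, f' (θ + d) ↔ f d) → π p' f' = transport θ σ (π p f))
    (hp : Valid (InField w h) p) (hmer : ¬ Merged p) (θ : Module → Fin 4) :
    (mergeAlgorithm π).moves w h p θ = π p (touching (InField w h) p) := by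
  funext m
  have H : ∃ q : Config × Module, Explains (observe 9 w h p (θ m) m) q.1 ∧ q.1 q.2 = 0 :=
    ⟨⟨_, m⟩, explains_observe hp hmer, by simp⟩
  rw [Algorithm.moves, mergeAlgorithm, dif_pos H]
  obtain ⟨hq, h0⟩ := H.choose_spec
  set q := H.choose
  obtain ⟨σ, hσ⟩ := exists_perm_of_explains hp hq
  have hsim := Similar.of_not_merged hσ hq.connected hq.not_merged hp.connected
  rw [hπ _ _ _ _ _ _ _ hsim fun d => (seesTouching_observe hp d).symm, transport]
  congr 2
  refine hq.injective (h0.trans ?_)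
  have := hσ m
  rw [right_eq_add] at this
  refine rot_injective (θ m) ?_
  rw [this]
  simpa using rot_zsmul (θ m) 0 0

end observation

/-! ### Executions -/

theorem LegalIn.legal {w h : ℕ} {p : Config} {a : Module → Move} (ha : LegalIn (InField w h) p a) :
    Legal w h p a where
  guided := ha.guided
  inField := ha.inField
  empty := ha.empty
  noOverlap := ha.noOverlap
  backbone := ha.backbone
  connected := ha.connected

theorem Move.eq_stay_or_dest_mem {p : Config} {a : Module → Move} {m : Module}
    (hg : Guided p a m) : a m = .stay ∨ (a m).dest (p m) ∈ (a m).trajectory (p m) := by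
  unfold Guided at hg
  cases h : a m with
  | stay => exact Or.inl rfl
  | rotate d ccw => right; simp [trajectory, dest]
  | slide d l =>
    right
    rw [h] at hg
    have := hg.1
    simp only [trajectory_slide, dest, List.mem_map, List.mem_range]
    refine ⟨l - 1, by omega, ?_⟩
    push_cast [this]
    simp

theorem LegalIn.valid_step {F : Cell → Prop} {p : Config} {a : Module → Move}
    (ha : LegalIn F p a) (hp : Valid F p) (hv : AllVisible 9 (step p a)) :
    Valid F (step p a) := by
  have hd : ∀ m, step p a m = p m ∧ a m = .stay ∨
      step p a m ∈ (a m).trajectory (p m) := fun m => by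
    rcases Move.eq_stay_or_dest_mem (ha.guided m) with h | h
    · left; simp [step, h, Move.dest]
    · exact Or.inr h
  refine ⟨fun m m' e => ?_, ha.connected, fun m => ?_, hv⟩
  · by_contra hne
    rcases hd m with h | h <;> rcases hd m' with h' | h'
    · exact hne (hp.injective (h.1.symm.trans (e.trans h'.1)))
    · exact ha.empty m' _ h' m (by rw [← e, h.1])
    · exact ha.empty m _ h m' (by rw [e, h'.1])
    · exact ha.noOverlap m m' hne h (e ▸ h')
  · rcases hd m with h | h
    · rw [h.1]; exact hp.mem m
    · exact ha.inField m _ h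

theorem legal_stay {w h : ℕ} {p : Config} (hp : Valid (InField w h) p) :
    Legal w h p fun _ => .stay where
  guided _ := trivial
  inField _ _ hc := by simp [Move.trajectory] at hc
  empty _ _ hc := by simp [Move.trajectory] at hc
  noOverlap _ _ _ := by simp [Move.trajectory]
  backbone i := by simpa using hp.connected i
  connected i := hp.connected i

/-- If all positions are winnable, then an optimal equivariant policy solves the merge problem: the
number of steps needed decreases until the MRSs have merged. -/
theorem exists_algorithm_of_winnable
    (H : ∀ F p, IsField F → Valid F p → Winnable p (touching F p)) :
    ∃ A : Algorithm 9, ∀ w h : ℕ, 4 ≤ w → 4 ≤ h → ∀ p : Config,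
      IsConfiguration w h p → AllVisible 9 p → A.SolvesMergeFrom w h p := by
  obtain ⟨π, hopt, hπ⟩ := exists_policy
  refine ⟨mergeAlgorithm π, fun w h hw hh p hp hvis θ => ?_⟩
  set A := mergeAlgorithm π
  set F := InField w h
  have hF : IsField F := isField_inField hw hh
  set P : ℕ → Config := A.execution w h p θ with hP
  have hsucc : ∀ t, P (t + 1) = step (P t) (A.moves w h (P t) (θ t)) := fun t => rfl
  have hstay : ∀ t, Valid F (P t) → Merged (P t) → A.moves w h (P t) (θ t) = fun _ => .stay :=
    fun t hv hm => funext fun m => mergeAlgorithm_moves_of_merged hv hm (θ t) m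
  have hmove : ∀ t, Valid F (P t) → ¬ Merged (P t) →
      LegalIn F (P t) (A.moves w h (P t) (θ t)) ∧ AllVisible 9 (P (t + 1)) ∧
      ∀ n, Winning n (P t) (touching F (P t)) →
        ∃ k < n, Winning k (P (t + 1)) (touching F (P (t + 1))) := by
    intro t hv hm
    rw [hsucc, mergeAlgorithm_moves hπ hv hm]
    obtain ⟨n₀, hn₀⟩ := H F _ hF hv
    have hstep := fun n hn => (hopt (P t) (touching F (P t))).2 hm n hn F hF hv.mem rfl
    exact ⟨(hstep n₀ hn₀).1, (hstep n₀ hn₀).2.1, fun n hn => (hstep n hn).2.2⟩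
  have hvalid : ∀ t, Valid F (P t) := by
    intro t
    induction t with
    | zero => exact ⟨hp.injective, hp.connected, hp.inField, hvis⟩
    | succ t ih =>
      by_cases hm : Merged (P t)
      · rw [hsucc, hstay t ih hm]; exact ih
      · exact (hmove t ih hm).1.valid_step ih (hmove t ih hm).2.1
  have hmerge : ∀ n t, Winning n (P t) (touching F (P t)) → ∃ T, Merged (P T) := by
    intro n
    induction n using Nat.strong_induction_on with
    | _ n ih =>
      intro t hn
      by_cases hm : Merged (P t)
      · exact ⟨t, hm⟩
      · obtain ⟨k, hk, hw⟩ := (hmove t (hvalid t) hm).2.2 n hn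
        exact ih k hk _ hw
  refine ⟨fun t => ?_, ?_⟩
  · by_cases hm : Merged (P t)
    · rw [hstay t (hvalid t) hm]; exact legal_stay (hvalid t)
    · exact (hmove t (hvalid t) hm).1.legal
  · obtain ⟨n, hn⟩ := H F _ hF (hvalid 0)
    obtain ⟨T, hT⟩ := hmerge n 0 hn
    have hconst : ∀ t, T ≤ t → Merged (P t) := by
      intro t ht
      induction t, ht using Nat.le_induction with
      | base => exact hT
      | succ t _ ih => rw [hsucc, hstay t (hvalid t) ih]; exact ih
    exact ⟨T, hT, fun t ht m => congrFun (hstay t (hvalid t) (hconst t ht)) m⟩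

/-! ### Moving one module per MRS -/

/-- The movement `v` of the module `m` is guided by other modules of its own MRS. Only rotations and
slides by one cell are considered. -/
def GuidedByOwn (p : Config) (m : Module) : Move → Prop
  | .stay => False
  | .rotate d _ => ∃ m', m'.1 = m.1 ∧ m' ≠ m ∧ p m' = p m + d.vec
  | .slide d l => l = 1 ∧ ∃ e : Direction, (e = d + 1 ∨ e = d + 3) ∧
      (∃ m', m'.1 = m.1 ∧ m' ≠ m ∧ p m' = p m + e.vec) ∧
      ∃ m', m'.1 = m.1 ∧ m' ≠ m ∧ p m' = p m + d.vec + e.vec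

/-- The module `m` alone can make the movement `v`, as far as its own MRS is concerned. -/
structure CanMove (p : Config) (m : Module) (v : Move) : Prop where
  guided : GuidedByOwn p m v
  free : ∀ c ∈ v.trajectory (p m), ∀ m', m'.1 = m.1 → p m' ≠ c
  rest : ConnectedOn p {m' | m'.1 = m.1 ∧ m' ≠ m}

theorem GuidedByOwn.similar {θ : Fin 4} {t : Cell} {σ : Equiv.Perm Module} {p p' : Config}
    (h : Similar θ t σ p p') {m : Module} {v : Move} (hv : GuidedByOwn p (σ m) v) :
    GuidedByOwn p' m (v.toGlobal θ) := by
  have key : ∀ c : Cell, (∃ m', m'.1 = (σ m).1 ∧ m' ≠ σ m ∧ p m' = p (σ m) + c) →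
      ∃ m', m'.1 = m.1 ∧ m' ≠ m ∧ p' m' = p' m + rot θ c := by
    rintro c ⟨m', h1, h2, h3⟩
    refine ⟨σ⁻¹ m', ?_, ?_, ?_⟩
    · rw [← h.fst_eq_iff]; simpa using h1
    · rintro rfl; simp at h2
    · rw [h.apply_eq, h.apply_eq m, show σ (σ⁻¹ m') = m' by simp, h3, rot_add]
      abel
  cases v with
  | stay => exact hv
  | rotate d ccw =>
    have := key _ hv
    rwa [rot_vec] at this
  | slide d l =>
    obtain ⟨hl, e, he, h1, h2⟩ := hv
    refine ⟨hl, θ + e, ?_, ?_, ?_⟩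
    · rcases he with rfl | rfl
      · left; abel
      · right; abel
    · have := key _ h1
      rwa [rot_vec] at this
    · have := key (d.vec + e.vec) (by simpa only [add_assoc] using h2)
      rwa [rot_add, rot_vec, rot_vec, ← add_assoc] at this

theorem CanMove.similar {θ : Fin 4} {t : Cell} {σ : Equiv.Perm Module} {p p' : Config}
    (h : Similar θ t σ p p') {m : Module} {v : Move} (hv : CanMove p (σ m) v) :
    CanMove p' m (v.toGlobal θ) where
  guided := hv.guided.similar h
  free c hc m' hm' e := by
    rw [h.apply_eq m, Move.trajectory_toGlobal, List.mem_map] at hc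
    obtain ⟨x, hx, rfl⟩ := hc
    rw [h.apply_eq] at e
    exact hv.free x hx _ ((h.fst_eq_iff _ _).2 hm') (rot_injective θ (add_right_cancel e))
  rest := by
    refine Eq.mp ?_ ((h.connectedOn_iff _).2 hv.rest)
    congr 1
    ext m'
    simp [h.fst_eq_iff]

theorem trajectory_slide_one (c : Cell) (d : Direction) :
    (Move.slide d 1).trajectory c = [c + d.vec] := by
  simp [Move.trajectory_slide]

/-- The first cell of a trajectory is next to the moving module, and the destination is next to a
guiding module, so that the movement does not run into another MRS unless the two have merged. -/
theorem CanMove.sideAdjacent {p : Config} {m : Module} {v : Move} (h : CanMove p m v) :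
    (∃ m', m'.1 = m.1 ∧ m' ≠ m ∧ SideAdjacent (v.dest (p m)) (p m')) ∧
      ∀ c ∈ v.trajectory (p m), ∃ m', m'.1 = m.1 ∧ SideAdjacent c (p m') := by
  have hg := h.guided
  cases v with
  | stay => exact hg.elim
  | rotate d ccw =>
    obtain ⟨m', h1, h2, h3⟩ := hg
    have hd : SideAdjacent ((Move.rotate d ccw).dest (p m)) (p m') := by
      rw [h3, Move.dest, add_right_comm]
      exact (sideAdjacent_add_vec _ _).symm
    refine ⟨⟨m', h1, h2, hd⟩, fun c hc => ?_⟩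
    simp only [Move.trajectory, List.mem_cons, List.not_mem_nil, or_false] at hc
    rcases hc with rfl | rfl
    · exact ⟨m, rfl, (sideAdjacent_add_vec _ _).symm⟩
    · exact ⟨m', h1, hd⟩
  | slide d l =>
    obtain ⟨rfl, e, -, -, m', h1, h2, h3⟩ := hg
    refine ⟨⟨m', h1, h2, ?_⟩, fun c hc => ?_⟩
    · rw [h3, Move.dest, Nat.cast_one, one_smul]
      exact sideAdjacent_add_vec _ _
    · rw [trajectory_slide_one, List.mem_singleton] at hc
      subst hc
      exact ⟨m, rfl, (sideAdjacent_add_vec _ _).symm⟩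

/-- As long as the two MRSs have not merged, one module of each MRS can move without regard to the
other MRS, provided that the trajectories are disjoint. -/
theorem legalIn_of_canMove {F : Cell → Prop} {p : Config} {a : Module → Move}
    (hconn : ∀ i : Fin 2, ConnectedOn p {m | m.1 = i})
    (hmer : ¬ Merged p) (ha : ∀ m, a m ≠ .stay → CanMove p m (a m))
    (huniq : ∀ m m', a m ≠ .stay → a m' ≠ .stay → m.1 = m'.1 → m = m')
    (hF : ∀ m, ∀ c ∈ (a m).trajectory (p m), F c)
    (hdisj : ∀ m m', m.1 ≠ m'.1 →
      List.Disjoint ((a m).trajectory (p m)) ((a m').trajectory (p m'))) :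
    LegalIn F p a := by
  have hstay : ∀ m m', a m ≠ .stay → m'.1 = m.1 → m' ≠ m → a m' = .stay := fun m m' h h1 h2 =>
    by_contra fun h' => h2 (huniq m' m h' h h1)
  have htraj : ∀ m, a m = .stay → (a m).trajectory (p m) = [] := fun m h => by
    rw [h]; rfl
  have hset : ∀ m, a m ≠ .stay →
      {m' | m'.1 = m.1 ∧ a m' = .stay} = {m' | m'.1 = m.1 ∧ m' ≠ m} := by
    intro m hm
    ext m'
    simp only [Set.mem_ofPred_eq]
    refine and_congr_right fun h1 => ⟨?_, fun h2 => hstay m m' hm h1 h2⟩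
    rintro h2 rfl
    exact hm h2
  have hrest : ∀ i, (∀ m, m.1 = i → a m = .stay) ∨ ∃ m, m.1 = i ∧ a m ≠ .stay := fun i => by
    by_cases h : ∃ m, m.1 = i ∧ a m ≠ .stay
    · exact Or.inr h
    · left; push Not at h; exact h
  refine ⟨fun m => ?_, hF, fun m c hc m' e => ?_, fun m m' hne => ?_, fun i => ?_, fun i => ?_⟩
  · by_cases h : a m = .stay
    · simp [Guided, h]
    have hc := (ha m h).guided
    unfold Guided
    cases hv : a m with
    | stay => trivial
    | rotate d ccw =>
      rw [hv] at hc
      obtain ⟨m', h1, h2, h3⟩ := hc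
      exact ⟨m', h3, hstay m m' h h1 h2⟩
    | slide d l =>
      rw [hv] at hc
      obtain ⟨rfl, e, he, ⟨m', h1, h2, h3⟩, m'', h1', h2', h3'⟩ := hc
      refine ⟨le_rfl, e, he, fun i hi => ?_⟩
      interval_cases i
      · exact ⟨m', by simpa using h3, hstay m m' h h1 h2⟩
      · exact ⟨m'', by simpa using h3', hstay m m'' h h1' h2'⟩
  · by_cases h : a m = .stay
    · simp [htraj m h] at hc
    by_cases h1 : m'.1 = m.1
    · exact (ha m h).free c hc m' h1 e
    · obtain ⟨m'', h2, h3⟩ := (ha m h).sideAdjacent.2 c hc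
      exact hmer (merged_of_sideAdjacent hconn (h2.symm ▸ h1) (e ▸ h3))
  · by_cases h1 : m.1 = m'.1
    · by_cases h : a m = .stay
      · simp [htraj m h]
      · simp [htraj m' (hstay m m' h h1.symm hne.symm)]
    · exact hdisj m m' h1
  · rcases hrest i with h | ⟨m, rfl, hm⟩
    · convert hconn i using 1
      ext m
      exact ⟨fun hm => hm.1, fun hm => ⟨hm, h m hm⟩⟩
    · rw [hset m hm]
      exact (ha m hm).rest
  · rcases hrest i with h | ⟨m, rfl, hm⟩
    · exact (hconn i).congr fun m hm => by simp [step, h m hm, Move.dest]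
    · obtain ⟨m', h1, h2, h3⟩ := (ha m hm).sideAdjacent.1
      have hcong : ∀ x ∈ {m' | m'.1 = m.1 ∧ m' ≠ m}, step p a x = p x := fun x hx => by
        simp [step, hstay m x hm hx.1 hx.2, Move.dest]
      have := ((ha m hm).rest.congr hcong).insert (m := m) (m' := m') ⟨h1, h2⟩
        (by rw [hcong m' ⟨h1, h2⟩]; exact h3)
      convert this using 1
      ext x
      simp only [Set.mem_ofPred_eq, Set.mem_insert_iff]
      constructor
      · intro hx
        by_cases hxm : x = m
        · exact Or.inl hxm
        · exact Or.inr ⟨hx, hxm⟩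
      · rintro (rfl | hx)
        · rfl
        · exact hx.1

/-! ### Cells close to the configuration -/

/-- The cell `c` lies in the bounding box of the configuration. -/
def InHull (p : Config) (c : Cell) : Prop := ∀ d : Direction, ∃ m, dot (c - p m) d.vec ≤ 0

/-- The cell `c` lies in the bounding box of the configuration, enlarged by one cell on both sides
in the dimension in which the box is at most three cells thick. -/
def NearHull (p : Config) (c : Cell) : Prop :=
  ∀ d : Direction, ∃ m, dot (c - p m) d.vec ≤ 0 ∨ Thin p d ∧ dot (c - p m) d.vec ≤ 1

theorem InHull.nearHull {p : Config} {c : Cell} (h : InHull p c) : NearHull p c :=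
  fun d => (h d).imp fun _ => Or.inl

theorem Thin.opposite {p : Config} {d : Direction} (h : Thin p d) : Thin p (d + 2) := by
  intro m m'
  have := h m' m
  rw [vec_add_two, dot_neg_right, dot_sub_left]
  rw [dot_sub_left] at this
  linarith

theorem inHull_self (p : Config) (m : Module) : InHull p (p m) := fun d => ⟨m, by simp [dot]⟩

theorem allVisible_step {p p' : Config} (hp : AllVisible 9 p) (h : ∀ m, NearHull p (p' m)) :
    AllVisible 9 p' := by
  intro m m'
  rw [inRange_iff_dot]
  intro d
  obtain ⟨m₁, h₁⟩ := h m' d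
  obtain ⟨m₂, h₂⟩ := h m (d + 2)
  have h₃ := inRange_iff_dot.1 (hp m₂ m₁) d
  rw [vec_add_two, dot_neg_right] at h₂
  rw [dot_sub_left] at h₁ h₂ h₃ ⊢
  push_cast at *
  rcases h₁ with h₁ | ⟨ht, h₁⟩
  · rcases h₂ with h₂ | ⟨ht, h₂⟩
    · linarith
    · have := ht.opposite m₁ m₂
      rw [add_assoc, show (2 + 2 : Fin 4) = 0 from rfl, add_zero, dot_sub_left] at this
      linarith
  · have := ht m₁ m₂
    rw [dot_sub_left] at this
    rcases h₂ with h₂ | ⟨-, h₂⟩ <;> linarith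

theorem thin_of_inHull {p p' : Config} {d : Direction} (hp : Thin p d) (h : ∀ m, InHull p (p' m)) :
    Thin p' d := by
  intro m' m
  obtain ⟨m₁, h₁⟩ := h m' d
  obtain ⟨m₂, h₂⟩ := h m (d + 2)
  have h₃ := hp m₁ m₂
  rw [vec_add_two, dot_neg_right] at h₂
  rw [dot_sub_left] at h₁ h₂ h₃ ⊢
  linarith

theorem dot_vec_vec_nonpos {d e : Direction} (h : e ≠ d) : dot d.vec e.vec ≤ 0 := by
  revert d e
  simp only [dot, Direction.vec]
  decide

section field

variable {F : Cell → Prop} {b : Direction → ℤ}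

theorem field_add_vec_iff (hF : ∀ c, F c ↔ ∀ d : Direction, dot c d.vec ≤ b d)
    {c : Cell} (hc : F c) (d : Direction) :
    F (c + d.vec) ↔ dot c d.vec + 1 ≤ b d := by
  rw [hF] at hc ⊢
  constructor
  · intro h
    have := h d
    rwa [dot_add_left, dot_vec_self] at this
  · intro h e
    rw [dot_add_left]
    by_cases he : e = d
    · subst he; rwa [dot_vec_self]
    · linarith [hc e, dot_vec_vec_nonpos he]

theorem InHull.field_mem (hF : ∀ c, F c ↔ ∀ d : Direction, dot c d.vec ≤ b d)
    {p : Config} (hp : ∀ m, F (p m)) {c : Cell} (hc : InHull p c) : F c := by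
  rw [hF]
  intro d
  obtain ⟨m, hm⟩ := hc d
  have := (hF _).1 (hp m) d
  rw [dot_sub_left] at hm
  linarith

/-- If the walls are touched symmetrically, then no wall is touched in a dimension in which the
configuration is at most three cells thick, since the field has at least four cells there. -/
theorem NearHull.field_mem (hF : ∀ c, F c ↔ ∀ d : Direction, dot c d.vec ≤ b d)
    (hb : ∀ d, 3 ≤ b d + b (d + 2)) {p : Config} (hp : ∀ m, F (p m))
    (hsym : ∀ d, touching F p d → touching F p (d + 2)) {c : Cell} (hc : NearHull p c) : F c := by
  rw [hF]
  intro d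
  obtain ⟨m, hm⟩ := hc d
  have hpm := (hF _).1 (hp m) d
  rw [dot_sub_left] at hm
  rcases hm with hm | ⟨ht, hm⟩
  · linarith
  · by_cases h : F (p m + d.vec)
    · rw [field_add_vec_iff hF (hp m)] at h
      linarith
    · obtain ⟨⟨m', h'⟩, -⟩ := hsym d ⟨⟨m, h⟩, ht⟩
      rw [field_add_vec_iff hF (hp _)] at h h'
      rw [vec_add_two, dot_neg_right] at h'
      have h1 := ht m m'
      rw [dot_sub_left] at h1
      have := hb d
      omega

end field

/-! ### Symmetric configurations -/

/-- The central symmetries of a configuration exchange the two MRSs: as an MRS has an odd number of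
modules, it would otherwise have a module in the center. -/
theorem Similar.fst_ne {t : Cell} {σ : Equiv.Perm Module} {p : Config} (h : Similar 2 t σ p p)
    (hp : Function.Injective p) (m : Module) : (σ m).1 ≠ m.1 := by
  intro hm
  have hσσ : σ * σ = 1 := by
    have := h.trans h
    rw [show (2 + 2 : Fin 4) = 0 from rfl] at this
    exact (this.eq_one_of_zero hp).2
  have hfst : ∀ m', (σ m').1 = m'.1 := by
    intro m'
    by_cases h1 : m'.1 = m.1
    · rw [h1, ← hm, h.fst_eq_iff, h1]
    · have h2 := (h.fst_eq_iff m' m).not.2 h1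
      rw [hm] at h2
      omega
  have hfix : ∀ i : Fin 2, ∃ j : Fin 5, σ (i, j) = (i, j) := by
    intro i
    have hpair : ∀ j, σ (i, j) = (i, (σ (i, j)).2) := fun j => Prod.ext (hfst (i, j)) rfl
    have hinv : Function.Involutive fun j : Fin 5 => (σ (i, j)).2 := by
      intro j
      simp only
      rw [← hpair, ← Equiv.Perm.mul_apply, hσσ, Equiv.Perm.one_apply]
    obtain ⟨j, hj⟩ := Equiv.Perm.exists_fixed_point_of_prime (p := 2) (n := 1)
      (σ := hinv.toPerm) (by simp) (Equiv.ext fun j => by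
        rw [pow_one, sq]; exact hinv j)
    exact ⟨j, (hpair j).trans (by rw [show (σ (i, j)).2 = j from hj])⟩
  have hcenter : ∀ m', σ m' = m' → p m' + p m' = t := fun m' hm' => by
    have := h.apply_eq m'
    rw [hm', rot_two] at this
    nth_rewrite 1 [this]
    abel
  obtain ⟨j₀, h₀⟩ := hfix 0
  obtain ⟨j₁, h₁⟩ := hfix 1
  have e := (hcenter _ h₀).trans (hcenter _ h₁).symm
  have : p (0, j₀) = p (1, j₁) := by
    have e1 := congrArg Prod.fst e
    have e2 := congrArg Prod.snd e
    simp only [Prod.fst_add, Prod.snd_add] at e1 e2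
    exact Prod.ext (by omega) (by omega)
  simpa using congrArg Prod.fst (hp this)

/-- There are no rotational symmetries of order four: their squares would not exchange the two
MRSs. -/
theorem Similar.two_of_ne_zero {θ : Fin 4} {t : Cell} {σ : Equiv.Perm Module} {p : Config}
    (h : Similar θ t σ p p) (hp : Function.Injective p) (hθ : θ ≠ 0) : θ = 2 := by
  by_contra hθ2
  have h2 := h.trans h
  rw [show θ + θ = 2 by omega] at h2
  refine h2.fst_ne hp 0 ?_
  rw [Equiv.Perm.mul_apply]
  by_cases h0 : (σ 0).1 = (0 : Module).1
  · rw [(h.fst_eq_iff (σ 0) 0).2 h0, h0]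
  · have := (h.fst_eq_iff (σ 0) 0).not.2 h0
    omega

/-- The renaming of the modules that exchanges the two MRSs. -/
def flip : Equiv.Perm Module := (Equiv.swap 0 1).prodCongr (Equiv.refl _)

theorem flip_apply_zero (j : Fin 5) : flip (0, j) = (1, j) := by simp [flip]

theorem flip_apply_one (j : Fin 5) : flip (1, j) = (0, j) := by simp [flip]

theorem flip_mul_flip : flip * flip = 1 := by
  ext m : 1
  simp [flip, Prod.map]

theorem flip_fst_eq_iff (m m' : Module) : (flip m).1 = (flip m').1 ↔ m.1 = m'.1 := by
  simp [flip]

/-- The point reflection `x ↦ c - x` maps the `j`-th module of each MRS to the `j`-th module of the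
other one. -/
def Antipodal (c : Cell) (p : Config) : Prop := Similar 2 c flip p p

theorem antipodal_iff {c : Cell} {p : Config} :
    Antipodal c p ↔ ∀ j, p (1, j) = c - p (0, j) := by
  constructor
  · intro h j
    rw [h.apply_eq (1, j), flip_apply_one, rot_two]; abel
  · intro h
    refine ⟨?_, flip_fst_eq_iff⟩
    rintro ⟨i, j⟩
    rw [rot_two]
    fin_cases i
    · exact (by rw [flip_apply_zero, h j]; abel : p (0, j) = -p (flip (0, j)) + c)
    · exact (by rw [flip_apply_one, h j]; abel : p (1, j) = -p (flip (1, j)) + c)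

theorem exists_antipodal {t : Cell} {σ : Equiv.Perm Module} {p : Config} (h : Similar 2 t σ p p)
    (hp : Function.Injective p) : ∃ ρ p', Similar 0 0 ρ p p' ∧ Antipodal t p' := by
  have hne := h.fst_ne hp
  have h1 : ∀ j, (σ (0, j)).1 = 1 := fun j => by
    have : (σ (0, j)).1 ≠ 0 := hne (0, j)
    omega
  let s : Module → Module := fun m => if m.1 = 0 then m else σ (0, m.2)
  have hs0 : ∀ j, s (0, j) = (0, j) := fun j => rfl
  have hs1 : ∀ j, s (1, j) = σ (0, j) := fun j => rfl
  have hsfst : ∀ m, (s m).1 = m.1 := by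
    rintro ⟨i, j⟩
    fin_cases i
    · rfl
    · exact h1 j
  have hinj : Function.Injective s := by
    rintro ⟨i, j⟩ ⟨i', j'⟩ e
    have hi : i = i' := by simpa only [hsfst] using congrArg Prod.fst e
    subst hi
    fin_cases i
    · exact e
    · have := σ.injective (show σ (0, j) = σ (0, j') from e)
      simpa using this
  refine ⟨Equiv.ofBijective s (Finite.injective_iff_bijective.1 hinj), fun m => p (s m),
    ⟨fun m => by simp [rot_zero], fun m m' => by simp [hsfst]⟩, antipodal_iff.2 fun j => ?_⟩
  simp only [hs0, hs1]
  have := h.apply_eq (0, j)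
  rw [rot_two] at this
  rw [this]
  abel

/-! ### Winning strategies -/

/-- Only the module `m` moves. -/
def single (m : Module) (v : Move) : Module → Move := fun m' => if m' = m then v else .stay

/-- The `j`-th modules of both MRSs move symmetrically. -/
def symmetric (j : Fin 5) (v : Move) : Module → Move := fun m =>
  if m.2 = j then (if m.1 = 0 then v else v.toGlobal 2) else .stay

/-- The two MRSs can be made to merge by moving the first MRS only, one module at a time, within
the bounding box of the current configuration. -/
inductive Approaches : Config → Prop
  | merged {p : Config} : Merged p → Approaches p
  | step {p : Config} (j : Fin 5) (v : Move) : CanMove p (0, j) v →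
      (∀ c ∈ v.trajectory (p (0, j)), InHull p c) →
      Approaches (step p (single (0, j) v)) → Approaches p

/-- The two MRSs can be made to merge by symmetric movements in cells that are close to the
bounding box of the current configuration. -/
inductive SymmetricallyApproaches (c : Cell) : Config → Prop
  | merged {p : Config} : Merged p → SymmetricallyApproaches c p
  | step {p : Config} (j : Fin 5) (v : Move) : CanMove p (0, j) v →
      (∀ x ∈ v.trajectory (p (0, j)), NearHull p x) →
      (∀ x ∈ v.trajectory (p (0, j)), ∀ y ∈ v.trajectory (p (0, j)), x + y ≠ c) →
      SymmetricallyApproaches c (step p (symmetric j v)) → SymmetricallyApproaches c p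

theorem single_self (m : Module) (v : Move) : single m v m = v := if_pos rfl

theorem single_of_ne {m m' : Module} (h : m' ≠ m) (v : Move) : single m v m' = .stay := if_neg h

theorem step_single_self (p : Config) (m : Module) (v : Move) :
    step p (single m v) m = v.dest (p m) := by rw [step, single_self]

theorem step_single_of_ne (p : Config) {m m' : Module} (h : m' ≠ m) (v : Move) :
    step p (single m v) m' = p m' := by rw [step, single_of_ne h]; rfl

theorem GuidedByOwn.dest_mem {p : Config} {m : Module} {v : Move} (h : GuidedByOwn p m v) :
    v.dest (p m) ∈ v.trajectory (p m) := by
  cases v with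
  | stay => exact h.elim
  | rotate d ccw => simp [Move.dest, Move.trajectory]
  | slide d l =>
    obtain ⟨rfl, -⟩ := h
    simp [Move.dest, trajectory_slide_one]

section single

variable {p : Config} {j : Fin 5} {v : Move} {F : Cell → Prop}

theorem legalIn_single (hconn : ∀ i : Fin 2, ConnectedOn p {m | m.1 = i})
    (hmer : ¬ Merged p) (hv : CanMove p (0, j) v)
    (hF : ∀ c ∈ v.trajectory (p (0, j)), F c) : LegalIn F p (single (0, j) v) := by
  have hne : ∀ m, single (0, j) v m ≠ .stay → m = (0, j) := fun m hm =>
    by_contra fun h => hm (single_of_ne h v)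
  have htraj : ∀ m, m ≠ (0, j) → (single (0, j) v m).trajectory (p m) = [] := fun m hm => by
    rw [single_of_ne hm]; rfl
  refine legalIn_of_canMove hconn hmer (fun m hm => ?_) (fun m m' hm hm' _ => ?_)
    (fun m c hc => ?_) fun m m' hmm => ?_
  · rw [hne m hm, single_self]; exact hv
  · rw [hne m hm, hne m' hm']
  · by_cases h : m = (0, j)
    · rw [h, single_self] at hc; exact hF c hc
    · simp [htraj m h] at hc
  · by_cases h : m = (0, j)
    · rw [htraj m' fun h' => hmm (by rw [h, h'])]; simp
    · rw [htraj m h]; simp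

theorem inHull_step_single (hv : CanMove p (0, j) v)
    (hF : ∀ c ∈ v.trajectory (p (0, j)), InHull p c) (m : Module) :
    InHull p (step p (single (0, j) v) m) := by
  by_cases h : m = (0, j)
  · rw [h, step_single_self]; exact hF _ hv.guided.dest_mem
  · rw [step_single_of_ne p h]; exact inHull_self p m

theorem transport_flip_symmetric (j : Fin 5) (v : Move) :
    transport 2 flip (symmetric j v) = symmetric j v := by
  funext ⟨i, j'⟩
  fin_cases i
  · refine (?_ : ((symmetric j v (flip (0, j'))).toGlobal 2) = _)
    rw [flip_apply_zero]
    by_cases h : j' = j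
    · simp only [symmetric, h, if_true]
      exact (Move.toGlobal_toGlobal 2 2 v).trans (Move.toGlobal_zero v)
    · simp [symmetric, h, Move.toGlobal]
  · refine (?_ : ((symmetric j v (flip (1, j'))).toGlobal 2) = _)
    rw [flip_apply_one]
    by_cases h : j' = j
    · simp [symmetric, h]
    · simp [symmetric, h, Move.toGlobal]

theorem canMove_symmetric {c : Cell} (hp : Antipodal c p) (hv : CanMove p (0, j) v) (m : Module)
    (hm : symmetric j v m ≠ .stay) : CanMove p m (symmetric j v m) := by
  obtain ⟨i, j'⟩ := m
  by_cases h : j' = j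
  · subst h
    fin_cases i
    · simpa [symmetric] using hv
    · simpa [symmetric] using CanMove.similar hp (m := (1, j')) (by rwa [flip_apply_one])
  · simp [symmetric, h] at hm

theorem mem_trajectory_symmetric {c : Cell} (hp : Antipodal c p) {m : Module} {x : Cell}
    (hx : x ∈ (symmetric j v m).trajectory (p m)) :
    m.2 = j ∧ if m.1 = 0 then x ∈ v.trajectory (p (0, j)) else c - x ∈ v.trajectory (p (0, j)) := by
  obtain ⟨i, j'⟩ := m
  by_cases h : j' = j
  · subst h
    refine ⟨rfl, ?_⟩
    fin_cases i
    · simpa [symmetric] using hx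
    · have hx' : x ∈ (v.toGlobal 2).trajectory (p (1, j')) := by simpa [symmetric] using hx
      rw [hp.apply_eq (1, j'), flip_apply_one, Move.trajectory_toGlobal, List.mem_map] at hx'
      obtain ⟨y, hy, rfl⟩ := hx'
      simpa [rot_two] using hy
  · simp [symmetric, h, Move.trajectory] at hx

theorem NearHull.similar {θ : Fin 4} {t : Cell} {σ : Equiv.Perm Module} {p p' : Config}
    (h : Similar θ t σ p p') {c : Cell} (hc : NearHull p c) : NearHull p' (rot θ c + t) := by
  intro d
  obtain ⟨m, hm⟩ := hc (-θ + d)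
  refine ⟨σ⁻¹ m, ?_⟩
  rw [← h.thin_iff, ← dot_rot_vec θ, add_neg_cancel_left, rot_sub] at hm
  rw [h.apply_eq, show σ (σ⁻¹ m) = m by simp, add_sub_add_right_eq_sub]
  exact hm

theorem nearHull_symmetric {c : Cell} (hp : Antipodal c p)
    (hF : ∀ x ∈ v.trajectory (p (0, j)), NearHull p x) (m : Module) (x : Cell)
    (hx : x ∈ (symmetric j v m).trajectory (p m)) : NearHull p x := by
  have := (mem_trajectory_symmetric hp hx).2
  split_ifs at this
  · exact hF x this
  · have := NearHull.similar hp (hF _ this)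
    rwa [rot_two, neg_sub, sub_add_cancel] at this

theorem legalIn_symmetric {c : Cell} (hconn : ∀ i : Fin 2, ConnectedOn p {m | m.1 = i})
    (hmer : ¬ Merged p) (hp : Antipodal c p) (hv : CanMove p (0, j) v)
    (hF : ∀ m, ∀ x ∈ (symmetric j v m).trajectory (p m), F x)
    (hdisj : ∀ x ∈ v.trajectory (p (0, j)), ∀ y ∈ v.trajectory (p (0, j)), x + y ≠ c) :
    LegalIn F p (symmetric j v) := by
  refine legalIn_of_canMove hconn hmer (canMove_symmetric hp hv) (fun m m' hm hm' h => ?_)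
    hF fun m m' hmm x hx hx' => ?_
  · have key : ∀ m, symmetric j v m ≠ .stay → m.2 = j := fun m hm =>
      by_contra fun h => hm (if_neg h)
    exact Prod.ext h ((key m hm).trans (key m' hm').symm)
  · have h1 := (mem_trajectory_symmetric hp hx).2
    have h2 := (mem_trajectory_symmetric hp hx').2
    split_ifs at h1 h2 with h3 h4 h4
    · exact hmm (h3.trans h4.symm)
    · exact hdisj _ h1 _ h2 (by abel)
    · exact hdisj _ h1 _ h2 (by abel)
    · omega

end single

/-- A configuration in which all modules see each other. -/
structure Compact (p : Config) : Prop where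
  injective : Function.Injective p
  connected : ∀ i : Fin 2, ConnectedOn p {m | m.1 = i}
  visible : AllVisible 9 p

theorem Valid.compact {F : Cell → Prop} {p : Config} (h : Valid F p) : Compact p :=
  ⟨h.injective, h.connected, h.visible⟩

theorem Compact.similar {θ : Fin 4} {t : Cell} {σ : Equiv.Perm Module} {p p' : Config}
    (h : Similar θ t σ p p') (hp : Compact p) : Compact p' := by
  refine ⟨h.injective hp.injective, fun i => ?_, (h.allVisible_iff 9).2 hp.visible⟩
  refine Eq.mp ?_ ((h.connectedOn_iff _).2 (hp.connected (σ (i, 0)).1))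
  congr 1
  ext m
  simp [h.fst_eq_iff_fst_symm]

/-- If the wall in direction `1` is touched by the second MRS, the opposite wall is not touched, and
the walls are close, then the information on the walls breaks the symmetry, and continues to do so
while only the first MRS moves within the bounding box. -/
theorem winnable_of_touching {p : Config} {f : Direction → Prop} (happ : Approaches p)
    (hp : Compact p) (h1 : f 1) (h3 : ¬ f 3)
    (htop : ∃ j, ∀ m, dot (p m - p (1, j)) (Direction.vec 1) ≤ 0) : Winnable p f := by
  induction happ generalizing f with
  | merged h => exact h.winnable f
  | @step p j v hv hhull _ ih =>
    by_cases hmer : Merged p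
    · exact hmer.winnable f
    refine Winnable.of_step (a := single (0, j) v) ?_ ?_
    · intro θ t σ hsim hf
      have hθ : θ = 0 := by
        have e1 := hf 1
        have e2 := hf 2
        have e3 := hf 3
        have e0 := hf 0
        fin_cases θ
        · rfl
        · exact absurd (e2.2 (e1.2 h1)) h3
        · exact absurd (e1.2 h1) h3
        · exact absurd (e0.2 (e1.2 h1)) h3
      subst hθ
      rw [(hsim.eq_one_of_zero hp.injective).2, transport_zero_one]
    · rintro F ⟨b, hb, hF⟩ hpF rfl
      have hleg : LegalIn F p (single (0, j) v) := legalIn_single hp.connected hmer hv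
        fun c hc => (hhull c hc).field_mem hF hpF
      have hin := inHull_step_single hv hhull
      have hvis := allVisible_step hp.visible fun m => (hin m).nearHull
      have hval := hleg.valid_step ⟨hp.injective, hp.connected, hpF, hp.visible⟩ hvis
      obtain ⟨k, hk⟩ := htop
      have hk' : step p (single (0, j) v) (1, k) = p (1, k) :=
        step_single_of_ne p (by simp) v
      refine ⟨hleg, hvis, ih hval.compact ⟨⟨(1, k), ?_⟩, thin_of_inHull h1.2 hin⟩ ?_
        ⟨k, fun m => ?_⟩⟩
      · obtain ⟨m, hm⟩ := h1.1
        have := hk m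
        rw [hk', field_add_vec_iff hF (hpF _)]
        rw [field_add_vec_iff hF (hpF _)] at hm
        rw [dot_sub_left] at this
        omega
      · rintro ⟨⟨m, hm⟩, -⟩
        have hno : ∀ m, F (p m + Direction.vec 3) := fun m =>
          by_contra fun h => h3 ⟨⟨m, h⟩, h1.2.opposite⟩
        obtain ⟨m', hm'⟩ := hin m 3
        have := hno m'
        rw [field_add_vec_iff hF (hpF _)] at this
        rw [field_add_vec_iff hF (hval.mem _)] at hm
        rw [dot_sub_left] at hm'
        omega
      · rw [hk']
        obtain ⟨m', hm'⟩ := hin m 1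
        have := hk m'
        rw [dot_sub_left] at *
        omega

/-- Positions in which the information on the walls is asymmetric are winnable: the MRS moves that
is not needed to keep the touched wall in view. -/
theorem winnable_of_asymmetric (happ : ∀ p, Compact p → Approaches p) {p : Config}
    {f : Direction → Prop} (hp : Compact p) {d : Direction} (h1 : f d) (h3 : ¬ f (d + 2)) :
    Winnable p f := by
  obtain ⟨m, hm⟩ := Finite.exists_max fun m => dot (p m) d.vec
  obtain ⟨σ, hσ, j, hj⟩ : ∃ σ : Equiv.Perm Module,
      (∀ m m', (σ m).1 = (σ m').1 ↔ m.1 = m'.1) ∧ ∃ j, σ (1, j) = m := by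
    obtain ⟨i, j⟩ := m
    fin_cases i
    · exact ⟨flip, flip_fst_eq_iff, j, flip_apply_one j⟩
    · exact ⟨1, fun _ _ => Iff.rfl, j, rfl⟩
  have hsim : Similar (1 - d) 0 σ p fun m => rot (1 - d) (p (σ m)) :=
    ⟨fun m => (add_zero _).symm, hσ⟩
  have hw : Winnable (fun m => rot (1 - d) (p (σ m))) fun e => f (-(1 - d) + e) := by
    refine winnable_of_touching (happ _ (hp.similar hsim)) (hp.similar hsim) ?_ ?_ ⟨j, fun m' => ?_⟩
    · simpa using h1
    · rw [show -(1 - d) + 3 = d + 2 by clear * -; revert d; decide]; exact h3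
    · rw [← rot_sub, hj, show (1 : Direction) = (1 - d) + d by abel]
      rw [show 1 - d + d - d = 1 - d by abel, dot_rot_vec, dot_sub_left]
      linarith [hm (σ m')]
  exact hw.similar hsim.symm fun e => by rfl

/-- A symmetric position is won by symmetric movements, unless the walls break the symmetry. -/
theorem winnable_of_antipodal (happ : ∀ p, Compact p → Approaches p) {c : Cell} {p : Config}
    {f : Direction → Prop} (hsym : SymmetricallyApproaches c p) (hc : Antipodal c p)
    (hp : Compact p) : Winnable p f := by
  induction hsym generalizing f with
  | merged h => exact h.winnable f
  | @step p j v hv hhull hdisj _ ih =>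
    by_cases hmer : Merged p
    · exact hmer.winnable f
    by_cases hf : ∃ d, f d ∧ ¬ f (d + 2)
    · obtain ⟨d, h1, h3⟩ := hf
      exact winnable_of_asymmetric happ hp h1 h3
    push Not at hf
    refine Winnable.of_step (a := symmetric j v) ?_ ?_
    · intro θ t σ hsim _
      by_cases hθ : θ = 0
      · subst hθ
        rw [(hsim.eq_one_of_zero hp.injective).2, transport_zero_one]
      · cases hsim.two_of_ne_zero hp.injective hθ
        have := (Similar.eq_one_of_zero (hsim.trans hc) hp.injective).2
        have hσ : σ = flip := by
          rw [← mul_one σ, ← flip_mul_flip, ← mul_assoc, this, one_mul]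
        rw [hσ, transport_flip_symmetric]
    · rintro F ⟨b, hb, hF⟩ hpF rfl
      have hnear := nearHull_symmetric hc hhull
      have hleg : LegalIn F p (symmetric j v) := legalIn_symmetric hp.connected hmer hc hv
        (fun m x hx => (hnear m x hx).field_mem hF hb hpF hf) hdisj
      have hvis : AllVisible 9 (step p (symmetric j v)) := by
        refine allVisible_step hp.visible fun m => ?_
        rcases Move.eq_stay_or_dest_mem (hleg.guided m) with h | h
        · rw [step, h]; exact (inHull_self p m).nearHull
        · exact hnear m _ h
      have hval := hleg.valid_step ⟨hp.injective, hp.connected, hpF, hp.visible⟩ hvis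
      have hc' := Similar.step hc (symmetric j v)
      rw [transport_flip_symmetric] at hc'
      exact ⟨hleg, hvis, ih hc' hval.compact⟩

/-- All positions are winnable: an asymmetric position is won by moving one MRS only until either
the two MRSs merge or a symmetric position arises. -/
theorem winnable_of_compact (happ : ∀ p, Compact p → Approaches p)
    (hsym : ∀ c p, Compact p → Antipodal c p → SymmetricallyApproaches c p) {p : Config}
    (f : Direction → Prop) (hp : Compact p) : Winnable p f := by
  have := happ p hp
  induction this generalizing f with
  | merged h => exact h.winnable f
  | @step p j v hv hhull _ ih =>
    by_cases hmer : Merged p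
    · exact hmer.winnable f
    by_cases hs : ∃ θ t σ, θ ≠ 0 ∧ Similar θ t σ p p
    · obtain ⟨θ, t, σ, hθ, hsim⟩ := hs
      cases hsim.two_of_ne_zero hp.injective hθ
      obtain ⟨ρ, p', hpp', hc⟩ := exists_antipodal hsim hp.injective
      have hp' := hp.similar hpp'
      refine Winnable.similar hpp'.symm (f := f) (fun d => by simp) ?_
      exact winnable_of_antipodal happ (hsym t p' hp' hc) hc hp'
    · push Not at hs
      refine Winnable.of_step (a := single (0, j) v) ?_ ?_
      · intro θ t σ hsim _
        have hθ : θ = 0 := by_contra fun h => hs θ t σ h hsim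
        subst hθ
        rw [(hsim.eq_one_of_zero hp.injective).2, transport_zero_one]
      · rintro F ⟨b, hb, hF⟩ hpF rfl
        have hleg : LegalIn F p (single (0, j) v) := legalIn_single hp.connected hmer hv
          fun c hc => (hhull c hc).field_mem hF hpF
        have hvis := allVisible_step hp.visible fun m => (inHull_step_single hv hhull m).nearHull
        have hval := hleg.valid_step ⟨hp.injective, hp.connected, hpF, hp.visible⟩ hvis
        exact ⟨hleg, hvis, ih _ hval.compact⟩

/-! ### A finite computation with pentominoes -/

/-- Cells with natural coordinates. The computations with them are carried out by the kernel, which is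
fast on natural numbers if functions like `Nat.add` are applied directly. -/
abbrev NatCell := ℕ × ℕ

namespace NatCell

/-- The distance of two natural numbers. -/
def gap (a b : ℕ) : ℕ := Nat.add (Nat.sub a b) (Nat.sub b a)

/-- The neighbor in direction `d`. It is the true one if both coordinates are positive. -/
def neighbor : Direction → NatCell → NatCell
  | 0, z => (z.1 + 1, z.2)
  | 1, z => (z.1, z.2 + 1)
  | 2, z => (z.1 - 1, z.2)
  | 3, z => (z.1, z.2 - 1)

/-- The two cells are equal or side-adjacent. -/
def near (z w : NatCell) : Bool := Nat.ble (Nat.add (gap z.1 w.1) (gap z.2 w.2)) 1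

/-- Equality of cells. -/
def same (z w : NatCell) : Bool := Nat.beq z.1 w.1 && Nat.beq z.2 w.2

/-- Membership in a list of cells. -/
def mem (z : NatCell) (s : List NatCell) : Bool := s.any (same z)

/-- The squared distance of two cells. -/
def sqDist (z w : NatCell) : ℕ :=
  Nat.add (Nat.mul (gap z.1 w.1) (gap z.1 w.1)) (Nat.mul (gap z.2 w.2) (gap z.2 w.2))

/-- The cells of `s` other than `c`. -/
def remove (s : List NatCell) (c : NatCell) : List NatCell := s.filter fun z => !same z c

/-- The cells of `s` that are equal or side-adjacent to one of the cells of `l`. -/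
def spread (s l : List NatCell) : List NatCell := s.filter fun z => l.any (near z)

/-- The cells of `s` are connected by paths of length at most three from the first cell. For up to
four cells, this means that they are connected. -/
def isConnected : List NatCell → Bool
  | [] => false
  | r :: s => Nat.beq (spread (r :: s) (spread (r :: s) (spread (r :: s) [r]))).length
      (r :: s).length

/-- A movement `v` of the module on the cell `src` to the cell `dst`, through the cell `via`. In the
case of a slide, `via` is the destination. -/
structure LocalMove where
  src : NatCell
  v : Move
  via : NatCell
  dst : NatCell

/-- The movements of the module on the cell `c` of the MRS `s` that have to do with the side-adjacent
cell in direction `d`: if it is occupied, rotations around it, and otherwise the slide to it. -/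
def movesToward (s : List NatCell) (c : NatCell) (d : Direction) : List LocalMove :=
  let w := neighbor d c
  if mem w (remove s c) then
    [true, false].flatMap fun ccw =>
      let e := neighbor (Move.rotationSide d ccw) c
      let f := neighbor d e
      if !mem e s && !mem f s then [⟨c, .rotate d ccw, e, f⟩] else []
  else if [d + 1, d + 3].any fun e =>
      mem (neighbor e c) (remove s c) && mem (neighbor e w) (remove s c) then
    [⟨c, .slide d 1, w, w⟩]
  else []

/-- The movements of single modules of the MRS `s` in the absence of other modules. -/
def moves (s : List NatCell) : List LocalMove :=
  s.flatMap fun c =>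
    if Nat.ble 2 c.1 && Nat.ble 2 c.2 && isConnected (remove s c) then
      [0, 1, 2, 3].flatMap (movesToward s c)
    else []

/-- The MRS after a movement. -/
def update (s : List NatCell) (m : LocalMove) : List NatCell := m.dst :: remove s m.src

/-! #### One MRS approaching a fixed module -/

/-- The cell `z` lies in the bounding box of the cells of `s` and the cell `q`. -/
def inBox (s : List NatCell) (q z : NatCell) : Bool :=
  (q :: s).any (fun w => Nat.ble z.1 w.1) && (q :: s).any (fun w => Nat.ble w.1 z.1) &&
    ((q :: s).any (fun w => Nat.ble z.2 w.2) && (q :: s).any fun w => Nat.ble w.2 z.2)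

/-- The cells of `s` and the cell `q` do not lie in a common row or column. -/
def notCollinear (s : List NatCell) (q : NatCell) : Bool :=
  (s.any fun w => !Nat.beq w.1 q.1) && s.any fun w => !Nat.beq w.2 q.2

/-- Some movement lets the sum of the squared distances from `q` fall by more than `b`, or leads
to a cell next to `q`. -/
def approaches (s : List NatCell) (q : NatCell) (b : ℕ) : Bool :=
  (moves s).any fun m =>
    ((Nat.ble (Nat.succ (Nat.add (sqDist m.dst q) b)) (sqDist m.src q) &&
      notCollinear (update s m) q) || near m.dst q) &&
    (inBox s q m.via && inBox s q m.dst)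

/-- As `approaches`, with a preceding movement. -/
def approachesInTwo (s : List NatCell) (q : NatCell) : Bool :=
  (moves s).any fun m => inBox s q m.via && inBox s q m.dst &&
    approaches (update s m) q (sqDist m.dst q - sqDist m.src q)

/-- The statement on a pentomino `s` and a cell `q` that is verified by computation. -/
def approachable (s : List NatCell) (q : NatCell) : Bool :=
  !notCollinear s q || s.any (near q) || approaches s q 0 || approachesInTwo s q

/-! #### Two MRSs approaching each other symmetrically -/

/-- Twice the cell. -/
def double (z : NatCell) : NatCell := (Nat.add z.1 z.1, Nat.add z.2 z.2)

/-- The sum of two cells. -/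
def sum (z w : NatCell) : NatCell := (Nat.add z.1 w.1, Nat.add z.2 w.2)

/-- All numbers `2 * a`, where `a` is the image of a cell of `s` under the coordinate `x`, are within
distance `k` of `c`. In other words, `s` and its image under the reflection `a ↦ c - a` together
spread over at most `k + 1` lines. -/
def width (s : List NatCell) (x : NatCell → ℕ) (c k : ℕ) : Bool :=
  s.all fun z => Nat.ble (gap (Nat.add (x z) (x z)) c) k

/-- The number `a` lies in the range of the coordinate `x` on `s` and its image under the reflection
`a ↦ c - a`, enlarged by one on both sides if at most three numbers lie in the range. -/
def inWidth (s : List NatCell) (x : NatCell → ℕ) (c a : ℕ) : Bool :=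
  let k := (width s x c 2).toNat
  s.any (fun w => Nat.ble a (Nat.add (x w) k) || Nat.ble (Nat.add a (x w)) (Nat.add c k)) &&
    s.any fun w => Nat.ble (x w) (Nat.add a k) || Nat.ble c (Nat.add (Nat.add a (x w)) k)

/-- The cell `z` is close to the bounding box of `s` and its image under the reflection
`z ↦ c - z`. -/
def inSymmetricBox (s : List NatCell) (c z : NatCell) : Bool :=
  inWidth s Prod.fst c.1 z.1 && inWidth s Prod.snd c.2 z.2

/-- The trajectories of the movement `m` and of its image under the reflection `z ↦ c - z` are
disjoint. -/
def disjointFromImage (c : NatCell) (m : LocalMove) : Bool :=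
  !same (double m.via) c && !same (double m.dst) c && !same (sum m.via m.dst) c

/-- Some movement, made symmetrically, lets the sum of the squared distances of the doubled cells from
`c` fall by more than `b`, or leads to a cell next to the other MRS. -/
def approachesSymmetrically (s : List NatCell) (c : NatCell) (b : ℕ) : Bool :=
  (moves s).any fun m =>
    (Nat.ble (Nat.succ (Nat.add (sqDist (double m.dst) c) b)) (sqDist (double m.src) c) ||
      (update s m).any fun z => near (sum m.dst z) c) &&
    (disjointFromImage c m && (inSymmetricBox s c m.via && inSymmetricBox s c m.dst))

/-- As `approachesSymmetrically`, with a preceding symmetric movement. -/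
def approachesSymmetricallyInTwo (s : List NatCell) (c : NatCell) : Bool :=
  (moves s).any fun m =>
    disjointFromImage c m && (inSymmetricBox s c m.via && inSymmetricBox s c m.dst) &&
      approachesSymmetrically (update s m) c (sqDist (double m.dst) c - sqDist (double m.src) c)

/-- The statement on a pentomino `s` and the center of symmetry that is verified by computation. -/
def symmetricallyApproachable (s : List NatCell) (c : NatCell) : Bool :=
  approachesSymmetrically s c 0 || (s.any fun z => s.any fun w => near (sum z w) c) ||
    approachesSymmetricallyInTwo s c

/-! #### Enumeration of the pentominoes -/

/-- The polyomino encoded by the number `k`: the binary digits of `k` describe the rows of a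
`5 × 5` square whose lower left cell is `(10, 10)`. -/
def decode (k : ℕ) : List NatCell :=
  ((List.range 25).filter fun i => Nat.testBit k i).map fun i => (10 + i % 5, 10 + i / 5)

/-- The number that encodes a polyomino. -/
def encode (s : List NatCell) : ℕ :=
  s.foldr (fun z k => k + 2 ^ ((z.1 - 10) + 5 * (z.2 - 10))) 0

/-- Translate the polyomino to the right, or upward, if the cell `w` lies to the left of, or below,
the square used by `decode`. -/
def recenter (w : NatCell) (s : List NatCell) : List NatCell :=
  s.map fun z => (z.1 + (10 - w.1), z.2 + (10 - w.2))

/-- The polyominoes in `L` with an additional cell occur in `L'`. -/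
def growsInto (L L' : List ℕ) : Bool :=
  L.all fun k => (decode k).all fun z => [0, 1, 2, 3].all fun d : Direction =>
    let w := neighbor d z
    mem w (decode k) || (
      let s := recenter w (w :: decode k)
      L'.any (Nat.beq (encode s)) && s.all (fun z => mem z (decode (encode s))) &&
        (decode (encode s)).all fun z => mem z s)

/-- The polyominoes of `n + 1` cells, for `n ≤ 4`, up to translation. -/
def polyominoes : ℕ → List ℕ
  | 0 => [1]
  | 1 => [3, 33]
  | 2 => [7, 35, 67, 97, 98, 1057]
  | 3 => [15, 39, 71, 99, 102, 135, 195, 225, 226, 228, 1059, 1121, 1122, 2115, 2145, 2146, 3105,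
      3138, 33825]
  | _ => [31, 47, 79, 103, 110, 143, 167, 199, 227, 229, 230, 236, 271, 391, 451, 481, 482, 484, 488,
      1063, 1123, 1126, 1249, 1250, 1252, 2119, 2147, 2150, 2243, 2273, 2274, 2276, 3107,
      3139, 3142, 3169, 3170, 3266, 3268, 4231, 4291, 4321, 4322, 4324, 6211, 6241, 6242,
      7201, 7234, 7300, 33827, 33889, 33890, 35873, 35906, 67651, 67681, 67682, 68641,
      68674, 99361, 100418, 1082401]

theorem polyominoes_growsInto :
    ∀ n < 4, growsInto (polyominoes n) (polyominoes (n + 1)) = true := by decide +kernel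

/-- All numbers in the range of the coordinate `x` on `s` are within distance `9` of `a`. -/
def within (s : List NatCell) (x : NatCell → ℕ) (a : ℕ) : Bool :=
  s.all fun z => Nat.ble (gap (x z) a) 9

/-- The number `a` is at most the average of `f` on the cells of `s`. -/
def belowAverage (s : List NatCell) (f : NatCell → ℕ) (a : ℕ) : Bool :=
  Nat.ble (s.map fun _ => a).sum (s.map f).sum

/-- All pentominoes and all cells `q` with which they fit into a `10 × 10` square pass the test. By
rotational symmetry, it suffices to consider cells to the lower left of the barycenter. -/
def allApproachable : Bool :=
  (polyominoes 4).all fun k =>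
    (List.range 25).all fun x =>
      !(within (decode k) Prod.fst x && belowAverage (decode k) Prod.fst x) ||
      (List.range 25).all fun y =>
        !(within (decode k) Prod.snd y && belowAverage (decode k) Prod.snd y) ||
        approachable (decode k) (x, y)

/-- All pentominoes and all centers of symmetry such that the pentomino and its image fit into a
`10 × 10` square pass the test. By rotational symmetry, it suffices to consider centers to the lower
left of the barycenter. -/
def allSymmetricallyApproachable : Bool :=
  (polyominoes 4).all fun k =>
    (List.range 40).all fun x =>
      !(width (decode k) Prod.fst x 9 && belowAverage (decode k) (fun z => z.1 + z.1) x) ||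
      (List.range 40).all fun y =>
        !(width (decode k) Prod.snd y 9 && belowAverage (decode k) (fun z => z.2 + z.2) y) ||
        symmetricallyApproachable (decode k) (x, y)

theorem allApproachable_eq_true : allApproachable = true := by decide +kernel

theorem allSymmetricallyApproachable_eq_true : allSymmetricallyApproachable = true := by
  decide +kernel

/-! ### Correctness of the computation -/

/-- The cell with the same coordinates. -/
def toCell (z : NatCell) : Cell := (z.1, z.2)

theorem toCell_injective : Function.Injective toCell := by
  intro z w h
  simpa [toCell, Prod.ext_iff] using h

theorem gap_cast (a b : ℕ) : (gap a b : ℤ) = |(a : ℤ) - b| := by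
  have : gap a b = (a - b) + (b - a) := rfl
  rw [this]
  rcases abs_cases ((a : ℤ) - b) with ⟨h, _⟩ | ⟨h, _⟩ <;> rw [h] <;> omega

theorem same_iff {z w : NatCell} : same z w = true ↔ z = w := by
  simp [same, Prod.ext_iff]

theorem mem_iff {z : NatCell} {s : List NatCell} : mem z s = true ↔ z ∈ s := by
  simp [mem, same_iff]

theorem mem_remove {z c : NatCell} {s : List NatCell} : z ∈ remove s c ↔ z ∈ s ∧ z ≠ c := by
  simp [remove, ← same_iff]

theorem near_iff {z w : NatCell} :
    near z w = true ↔ z = w ∨ SideAdjacent (toCell z) (toCell w) := by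
  have h : near z w = true ↔ |(z.1 : ℤ) - w.1| + |(z.2 : ℤ) - w.2| ≤ 1 := by
    rw [← gap_cast, ← gap_cast]
    simp only [near, Nat.ble_eq]
    exact_mod_cast Iff.rfl
  rw [h, SideAdjacent, Prod.ext_iff]
  simp only [toCell]
  rcases abs_cases ((z.1 : ℤ) - w.1) with ⟨h, _⟩ | ⟨h, _⟩ <;>
    rcases abs_cases ((z.2 : ℤ) - w.2) with ⟨h', _⟩ | ⟨h', _⟩ <;> rw [h, h'] <;> omega

theorem toCell_neighbor {z : NatCell} (h1 : 1 ≤ z.1) (h2 : 1 ≤ z.2) (d : Direction) :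
    toCell (neighbor d z) = toCell z + d.vec := by
  fin_cases d <;> simp [toCell, neighbor, Direction.vec, Prod.ext_iff, h1, h2] <;> omega

theorem neighbor_pos {z : NatCell} (h1 : 2 ≤ z.1) (h2 : 2 ≤ z.2) (d : Direction) :
    1 ≤ (neighbor d z).1 ∧ 1 ≤ (neighbor d z).2 := by
  fin_cases d <;> simp [neighbor] <;> omega

/-- The list `s`, translated by `t`, consists of the cells of the modules of `S`. -/
def Models (p : Config) (S : Set Module) (s : List NatCell) (t : Cell) : Prop :=
  ∀ c, (∃ m ∈ S, p m = c) ↔ ∃ z ∈ s, c = toCell z + t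

theorem Models.connectedOn {p : Config} {S : Set Module} {s : List NatCell} {t : Cell}
    (hM : Models p S s t) (hp : Function.Injective p) (hs : isConnected s = true) :
    ConnectedOn p S := by
  match s, hs with
  | r :: s, hs =>
    obtain ⟨m₀, hm₀, hr⟩ := (hM (toCell r + t)).2 ⟨r, by simp, rfl⟩
    let G := (sideGraph p).induce S
    let R : List NatCell → Prop := fun l => ∀ z ∈ l, z ∈ r :: s ∧
      ∀ m (hm : m ∈ S), p m = toCell z + t → G.Reachable ⟨m₀, hm₀⟩ ⟨m, hm⟩
    have h0 : R [r] := by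
      intro z hz
      rw [List.mem_singleton] at hz
      subst hz
      refine ⟨by simp, fun m hm h => ?_⟩
      cases hp (h.trans hr.symm)
      exact .refl _
    have hstep : ∀ l, R l → R (spread (r :: s) l) := by
      intro l hl z hz
      simp only [spread, List.mem_filter, List.any_eq_true] at hz
      obtain ⟨hz, w, hw, hzw⟩ := hz
      refine ⟨hz, fun m hm h => ?_⟩
      obtain ⟨hws, hwr⟩ := hl w hw
      obtain ⟨m', hm', h'⟩ := (hM (toCell w + t)).2 ⟨w, hws, rfl⟩
      have hreach := hwr m' hm' h'
      rcases near_iff.1 hzw with rfl | hadj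
      · cases hp (h.trans h'.symm)
        exact hreach
      · refine hreach.trans (SimpleGraph.Adj.reachable ?_)
        show SideAdjacent (p m') (p m)
        rw [h, h']
        simpa [rot_zero] using hadj.symm.map_rot 0 t
    have hall := hstep _ (hstep _ (hstep _ h0))
    have heq := (List.filter_sublist (l := r :: s)).eq_of_length (Nat.eq_of_beq_eq_true hs)
    change spread _ _ = _ at heq
    rw [heq] at hall
    have hreach : ∀ m (hm : m ∈ S), G.Reachable ⟨m₀, hm₀⟩ ⟨m, hm⟩ := by
      intro m hm
      obtain ⟨z, hz, h⟩ := (hM (p m)).1 ⟨m, hm, rfl⟩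
      exact (hall z hz).2 m hm h
    have : Nonempty ↥S := ⟨⟨m₀, hm₀⟩⟩
    exact ⟨fun a b => (hreach a.1 a.2).symm.trans (hreach b.1 b.2)⟩

theorem Models.remove {p : Config} {S : Set Module} {s : List NatCell} {t : Cell}
    (hM : Models p S s t) (hp : Function.Injective p) {m : Module} {c : NatCell}
    (hm : p m = toCell c + t) : Models p {m' | m' ∈ S ∧ m' ≠ m} (remove s c) t := by
  intro x
  constructor
  · rintro ⟨m', ⟨h1, h2⟩, rfl⟩
    obtain ⟨z, hz, h⟩ := (hM _).1 ⟨m', h1, rfl⟩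
    refine ⟨z, mem_remove.2 ⟨hz, ?_⟩, h⟩
    rintro rfl
    exact h2 (hp (h.trans hm.symm))
  · rintro ⟨z, hz, rfl⟩
    obtain ⟨hz, hne⟩ := mem_remove.1 hz
    obtain ⟨m', h1, h2⟩ := (hM _).2 ⟨z, hz, rfl⟩
    refine ⟨m', ⟨h1, ?_⟩, h2⟩
    rintro rfl
    exact hne (toCell_injective (add_right_cancel (h2.symm.trans hm)))

/-- The modules of the first MRS. -/
abbrev firstMRS : Set Module := {m | m.1 = 0}

theorem Models.update {p p' : Config} {s : List NatCell} {t : Cell}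
    (hM : Models p firstMRS s t) (hp : Function.Injective p) {j : Fin 5} {m : LocalMove}
    (hj : p (0, j) = toCell m.src + t) (hj' : p' (0, j) = toCell m.dst + t)
    (hne : ∀ i, i ≠ j → p' (0, i) = p (0, i)) : Models p' firstMRS (update s m) t := by
  have hR := hM.remove hp hj
  intro x
  simp only [NatCell.update, List.mem_cons, exists_eq_or_imp, ← hR x]
  constructor
  · rintro ⟨⟨i, k⟩, hi, rfl⟩
    obtain rfl : i = 0 := hi
    by_cases hk : k = j
    · left; rw [hk, hj']
    · right; exact ⟨(0, k), ⟨rfl, by simpa using hk⟩, (hne k hk).symm⟩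
  · rintro (rfl | ⟨⟨i, k⟩, ⟨hi, hk⟩, rfl⟩)
    · exact ⟨(0, j), rfl, hj'⟩
    · obtain rfl : i = 0 := hi
      exact ⟨(0, k), rfl, hne k (by simpa using hk)⟩

theorem Models.canMove {p : Config} {s : List NatCell} {t : Cell}
    (hM : Models p firstMRS s t) (hp : Function.Injective p) {m : LocalMove} (hm : m ∈ moves s) :
    ∃ j, p (0, j) = toCell m.src + t ∧ CanMove p (0, j) m.v ∧
      (∀ x ∈ m.v.trajectory (p (0, j)), x = toCell m.via + t ∨ x = toCell m.dst + t) ∧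
      m.v.dest (p (0, j)) = toCell m.dst + t := by
  simp only [moves, List.mem_flatMap] at hm
  obtain ⟨c, hc, hm⟩ := hm
  split_ifs at hm with hcond
  swap
  · simp at hm
  simp only [Bool.and_eq_true, Nat.ble_eq] at hcond
  obtain ⟨⟨hc1, hc2⟩, hconn⟩ := hcond
  obtain ⟨d, -, hm⟩ := List.mem_flatMap.1 hm
  obtain ⟨⟨i, j⟩, hi, hj⟩ := (hM _).2 ⟨c, hc, rfl⟩
  obtain rfl : i = 0 := hi
  have hR := hM.remove hp hj
  have hrest : ConnectedOn p {m' | m'.1 = ((0, j) : Module).1 ∧ m' ≠ (0, j)} :=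
    hR.connectedOn hp hconn
  have hown : ∀ z ∈ NatCell.remove s c, ∃ m' : Module,
      m'.1 = ((0, j) : Module).1 ∧ m' ≠ (0, j) ∧ p m' = toCell z + t := fun z hz => by
    obtain ⟨m', ⟨h1, h2⟩, h3⟩ := (hR _).2 ⟨z, hz, rfl⟩
    exact ⟨m', h1, h2, h3⟩
  have hfree : ∀ z, z ∉ s → ∀ m' : Module, m'.1 = ((0, j) : Module).1 → p m' ≠ toCell z + t := by
    intro z hz m' hm' h
    obtain ⟨w, hw, h'⟩ := (hM _).1 ⟨m', hm', h⟩
    cases toCell_injective (add_right_cancel h')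
    exact hz hw
  have hnb : ∀ e, toCell (neighbor e c) = toCell c + e.vec :=
    toCell_neighbor (by omega) (by omega)
  have hnb2 : ∀ e e', toCell (neighbor e (neighbor e' c)) = toCell c + e'.vec + e.vec :=
    fun e e' => by
      rw [toCell_neighbor (neighbor_pos hc1 hc2 e').1 (neighbor_pos hc1 hc2 e').2, hnb]
  simp only [movesToward] at hm
  split_ifs at hm with h1 h2
  · obtain ⟨ccw, -, hm⟩ := List.mem_flatMap.1 hm
    split_ifs at hm with h3
    swap
    · simp at hm
    rw [List.mem_singleton] at hm
    subst hm
    simp only [Bool.and_eq_true, Bool.not_eq_true', ← Bool.not_eq_true, mem_iff] at h1 h3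
    have hvia : p (0, j) + (Move.rotationSide d ccw).vec =
        toCell (neighbor (Move.rotationSide d ccw) c) + t := by rw [hj, hnb]; abel
    have hdst : p (0, j) + (Move.rotationSide d ccw).vec + d.vec =
        toCell (neighbor d (neighbor (Move.rotationSide d ccw) c)) + t := by
      rw [hj, hnb2]; abel
    have htraj : ∀ x ∈ (Move.rotate d ccw).trajectory (p (0, j)),
        x = toCell (neighbor (Move.rotationSide d ccw) c) + t ∨
        x = toCell (neighbor d (neighbor (Move.rotationSide d ccw) c)) + t := by
      intro x hx
      simp only [Move.trajectory, List.mem_cons, List.not_mem_nil, or_false] at hx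
      rwa [hdst, hvia] at hx
    refine ⟨j, hj, ⟨?_, fun x hx m' hm' => ?_, hrest⟩, htraj, hdst⟩
    · obtain ⟨m', h4, h5, h6⟩ := hown _ h1
      exact ⟨m', h4, h5, by rw [h6, hj, hnb]; abel⟩
    · rcases htraj x hx with rfl | rfl
      · exact hfree _ h3.1 m' hm'
      · exact hfree _ h3.2 m' hm'
  · rw [List.mem_singleton] at hm
    subst hm
    have hdst : p (0, j) + d.vec = toCell (neighbor d c) + t := by rw [hj, hnb]; abel
    have hws : neighbor d c ∉ s := by
      intro hws
      refine h1 (mem_iff.2 (mem_remove.2 ⟨hws, fun h => ?_⟩))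
      have := congrArg toCell h
      rw [hnb, add_eq_left] at this
      have hd := dot_vec_self d
      rw [this] at hd
      simp [dot] at hd
    simp only [List.any_eq_true, Bool.and_eq_true, mem_iff, List.mem_cons, List.not_mem_nil,
      or_false] at h2
    obtain ⟨e, he, h3, h4⟩ := h2
    refine ⟨j, hj, ⟨⟨rfl, e, he, ?_, ?_⟩, fun x hx m' hm' => ?_, hrest⟩, fun x hx => ?_, ?_⟩
    · obtain ⟨m', h5, h6, h7⟩ := hown _ h3
      exact ⟨m', h5, h6, by rw [h7, hj, hnb]; abel⟩
    · obtain ⟨m', h5, h6, h7⟩ := hown _ h4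
      exact ⟨m', h5, h6, by rw [h7, hj, hnb2]; abel⟩
    · rw [trajectory_slide_one, List.mem_singleton] at hx
      rw [hx, hdst]
      exact hfree _ hws m' hm'
    · rw [trajectory_slide_one, List.mem_singleton] at hx
      left; rw [hx, hdst]
    · rw [Move.dest, Nat.cast_one, one_smul, hdst]
  · simp at hm

end NatCell

/-! ### Every MRS is a pentomino -/

/-- A connected set of modules has a module whose removal leaves it connected. -/
theorem ConnectedOn.exists_remove {p : Config} {S : Set Module} (h : ConnectedOn p S)
    (hS : S.Nontrivial) : ∃ m ∈ S, ConnectedOn p {m' | m' ∈ S ∧ m' ≠ m} ∧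
      ∃ m' ∈ S, m' ≠ m ∧ SideAdjacent (p m') (p m) := by
  have : Nontrivial ↥S := hS.coe_sort
  obtain ⟨⟨m, hm⟩, hconn⟩ :=
    SimpleGraph.Connected.exists_connected_induce_compl_singleton_of_finite_nontrivial h
  refine ⟨m, hm, ?_, ?_⟩
  · let e : ((sideGraph p).induce S).induce {(⟨m, hm⟩ : ↥S)}ᶜ ≃g
        (sideGraph p).induce {m' | m' ∈ S ∧ m' ≠ m} :=
      { toFun := fun x => ⟨x.1.1, x.1.2, fun h => x.2 (Subtype.ext h)⟩
        invFun := fun x => ⟨⟨x.1, x.2.1⟩, fun h => x.2.2 (congrArg Subtype.val h)⟩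
        left_inv := fun _ => rfl
        right_inv := fun _ => rfl
        map_rel_iff' := Iff.rfl }
    exact e.connected_iff.1 hconn
  · obtain ⟨u, hu⟩ := exists_ne (⟨m, hm⟩ : ↥S)
    obtain ⟨w⟩ := h.preconnected ⟨m, hm⟩ u
    cases w with
    | nil => exact absurd rfl hu
    | @cons _ x _ hadj _ =>
      exact ⟨x.1, x.2, fun hx => hadj.ne (Subtype.ext hx.symm), SideAdjacent.symm hadj⟩

namespace NatCell

theorem decode_bounds {k : ℕ} {z : NatCell} (hz : z ∈ decode k) :
    10 ≤ z.1 ∧ z.1 ≤ 14 ∧ 10 ≤ z.2 ∧ z.2 ≤ 14 := by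
  simp only [decode, List.mem_map, List.mem_filter, List.mem_range] at hz
  obtain ⟨i, ⟨hi, -⟩, rfl⟩ := hz
  simp only
  omega

theorem decode_nodup (k : ℕ) : (decode k).Nodup := by
  refine (List.nodup_range.filter _).map_on ?_
  intro i hi j hj h
  simp only [Prod.mk.injEq] at h
  omega

theorem exists_models (n : ℕ) (hn : n ≤ 4) (p : Config) (hp : Function.Injective p)
    (S : Set Module) (hS : ConnectedOn p S) (hcard : S.ncard = n + 1) :
    ∃ k ∈ polyominoes n, ∃ t, Models p S (decode k) t := by
  induction n generalizing S with
  | zero =>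
    obtain ⟨m, rfl⟩ := Set.ncard_eq_one.1 hcard
    refine ⟨1, by simp [polyominoes], p m - (10, 10), fun c => ?_⟩
    have : decode 1 = [(10, 10)] := by decide
    simp [this, toCell, eq_comm]
  | succ n ih =>
    obtain ⟨m, hm, hconn, m', hm', hne, hadj⟩ := ConnectedOn.exists_remove hS
      (Set.one_lt_ncard_iff_nontrivial.1 (by omega))
    obtain ⟨k, hk, t, hM⟩ := ih (by omega) _ hconn (by
      have := Set.ncard_sdiff_singleton_of_mem hm
      rw [hcard] at this
      exact this)
    have hgrow := polyominoes_growsInto n (by omega)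
    obtain ⟨z, hz, hmz⟩ := (hM (p m')).1 ⟨m', ⟨hm', hne⟩, rfl⟩
    obtain ⟨d, hd⟩ := sideAdjacent_iff_exists_vec.1 hadj
    have hb := decode_bounds hz
    have hw : p m = toCell (neighbor d z) + t := by
      rw [hd, hmz, toCell_neighbor (by omega) (by omega)]; abel
    have hnot : neighbor d z ∉ decode k := by
      intro h
      obtain ⟨m'', ⟨-, h1⟩, h2⟩ := (hM _).2 ⟨_, h, rfl⟩
      exact h1 (hp (h2.trans hw.symm))
    simp only [growsInto, List.all_eq_true, Bool.or_eq_true, Bool.and_eq_true, mem_iff,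
      List.any_eq_true] at hgrow
    have hd4 : d ∈ ([0, 1, 2, 3] : List Direction) := by fin_cases d <;> simp
    obtain ⟨⟨⟨k', hk', he⟩, h1⟩, h2⟩ := (hgrow k hk z hz d hd4).resolve_left hnot
    cases Nat.eq_of_beq_eq_true he
    set w := neighbor d z
    set u : Cell := (((10 - w.1 : ℕ) : ℤ), ((10 - w.2 : ℕ) : ℤ))
    refine ⟨_, hk', t - u, fun c => ?_⟩
    have hrec : ∀ x : NatCell, toCell (x.1 + (10 - w.1), x.2 + (10 - w.2)) + (t - u) =
        toCell x + t := by
      intro x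
      simp only [toCell, u]
      ext <;> simp
    have hlist : (∃ z ∈ decode (encode (recenter w (w :: decode k))), c = toCell z + (t - u)) ↔
        ∃ x ∈ w :: decode k, c = toCell x + t := by
      constructor
      · rintro ⟨y, hy, rfl⟩
        obtain ⟨x, hx, rfl⟩ := List.mem_map.1 (h2 y hy)
        exact ⟨x, hx, hrec x⟩
      · rintro ⟨x, hx, rfl⟩
        exact ⟨_, h1 _ (List.mem_map_of_mem hx), (hrec x).symm⟩
    rw [hlist]
    simp only [List.mem_cons, exists_eq_or_imp, ← hM c]
    constructor
    · rintro ⟨m'', h, rfl⟩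
      by_cases hmm : m'' = m
      · left; rw [hmm, hw]
      · exact Or.inr ⟨m'', ⟨h, hmm⟩, rfl⟩
    · rintro (rfl | ⟨m'', ⟨h, -⟩, rfl⟩)
      · exact ⟨m, hm, hw⟩
      · exact ⟨m'', h, rfl⟩

theorem exists_models_firstMRS {p : Config} (hp : Compact p) :
    ∃ k ∈ polyominoes 4, ∃ t, Models p firstMRS (decode k) t := by
  refine exists_models 4 le_rfl p hp.injective _ (hp.connected 0) ?_
  have : firstMRS = Set.range fun j : Fin 5 => ((0, j) : Module) := by
    ext ⟨i, j⟩
    simp [eq_comm]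
  rw [this, Set.ncard_range_of_injective fun j j' h => (Prod.ext_iff.1 h).2]
  simp

/-- Sums over the modules of the first MRS can be computed from the list of cells. -/
theorem Models.sum_eq {p : Config} {k : ℕ} {t : Cell} (hM : Models p firstMRS (decode k) t)
    (hp : Function.Injective p) (g : Cell → ℤ) :
    ∑ j, g (p (0, j)) = ((decode k).map fun z => g (toCell z + t)).sum := by
  have hinj : Function.Injective fun z : NatCell => toCell z + t := fun z w h =>
    toCell_injective (add_right_cancel h)
  have himg : Finset.univ.image (fun j => p (0, j)) =
      ((decode k).map fun z => toCell z + t).toFinset := by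
    ext c
    have := hM c
    simp only [Finset.mem_image, Finset.mem_univ, true_and, List.mem_toFinset, List.mem_map]
    constructor
    · rintro ⟨j, rfl⟩
      obtain ⟨z, hz, h⟩ := this.1 ⟨(0, j), rfl, rfl⟩
      exact ⟨z, hz, h.symm⟩
    · rintro ⟨z, hz, rfl⟩
      obtain ⟨⟨i, j⟩, hi, h⟩ := this.2 ⟨z, hz, rfl⟩
      obtain rfl : i = 0 := hi
      exact ⟨j, h⟩
  have h1 : ∑ j, g (p (0, j)) = ∑ c ∈ Finset.univ.image (fun j => p (0, j)), g c := by
    rw [Finset.sum_image]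
    intro j _ j' _ h
    exact (Prod.ext_iff.1 (hp h)).2
  rw [h1, himg, List.sum_toFinset _ ((decode_nodup k).map hinj), List.map_map]
  rfl

end NatCell

/-! ### One MRS approaches a fixed module -/

theorem Approaches.similar {θ : Fin 4} {t : Cell} {p p' : Config} (h : Similar θ t 1 p p')
    (hp : Approaches p) : Approaches p' := by
  induction hp generalizing p' with
  | merged hm => exact .merged (h.merged_iff.2 hm)
  | @step p j v hv hhull _ ih =>
    refine .step j (v.toGlobal θ) (CanMove.similar h hv) (fun c hc => ?_) (ih ?_)
    · rw [h.apply_eq (0, j), Move.trajectory_toGlobal, List.mem_map] at hc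
      obtain ⟨x, hx, rfl⟩ := hc
      intro d
      obtain ⟨m, hm⟩ := hhull x hx (-θ + d)
      refine ⟨m, ?_⟩
      rw [h.apply_eq m, add_sub_add_right_eq_sub, Equiv.Perm.one_apply, ← rot_sub,
        ← add_neg_cancel_left θ d, dot_rot_vec]
      exact hm
    · have := h.step (single (0, j) v)
      convert this using 2
      funext m
      by_cases hm : m = (0, j) <;> simp [transport, single, hm, Move.toGlobal]

theorem SymmetricallyApproaches.similar {θ : Fin 4} {t c : Cell} {p p' : Config}
    (h : Similar θ t 1 p p') (hp : SymmetricallyApproaches c p) :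
    SymmetricallyApproaches (rot θ c + (t + t)) p' := by
  induction hp generalizing p' with
  | merged hm => exact .merged (h.merged_iff.2 hm)
  | @step p j v hv hhull hdisj _ ih =>
    have hmem : ∀ y ∈ (v.toGlobal θ).trajectory (p' (0, j)),
        ∃ x ∈ v.trajectory (p (0, j)), rot θ x + t = y := fun y hy => by
      rw [h.apply_eq (0, j), Move.trajectory_toGlobal, List.mem_map] at hy
      exact hy
    refine .step j (v.toGlobal θ) (CanMove.similar h hv) (fun y hy => ?_) (fun y hy z hz e => ?_)
      (ih ?_)
    · obtain ⟨x, hx, rfl⟩ := hmem y hy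
      exact NearHull.similar h (hhull x hx)
    · obtain ⟨x, hx, rfl⟩ := hmem y hy
      obtain ⟨w, hw, rfl⟩ := hmem z hz
      refine hdisj x hx w hw (rot_injective θ (add_right_cancel (b := t + t) ?_))
      rw [← e, rot_add]; abel
    · have := h.step (symmetric j v)
      convert this using 2
      funext m
      by_cases hm : m.2 = j
      · by_cases hm' : m.1 = 0 <;>
          simp [transport, symmetric, hm, hm', Move.toGlobal_toGlobal, add_comm]
      · simp [transport, symmetric, hm, Move.toGlobal]

/-- Every vector can be rotated into the closed first quadrant. -/
theorem exists_rot_nonneg (u : Cell) : ∃ θ, 0 ≤ (rot θ u).1 ∧ 0 ≤ (rot θ u).2 := by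
  rcases le_total 0 u.1 with h1 | h1 <;> rcases le_total 0 u.2 with h2 | h2
  · exact ⟨0, by simpa [rot] using h1, by simpa [rot] using h2⟩
  · exact ⟨1, by simpa [rot] using h2, by simpa [rot] using h1⟩
  · exact ⟨3, by simpa [rot] using h2, by simpa [rot] using h1⟩
  · exact ⟨2, by simpa [rot] using h1, by simpa [rot] using h2⟩

theorem rot_sum {ι : Type*} (θ : Fin 4) (s : Finset ι) (f : ι → Cell) :
    rot θ (∑ i ∈ s, f i) = ∑ i ∈ s, rot θ (f i) := by
  classical
  induction s using Finset.induction_on with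
  | empty => simpa using rot_zsmul θ 0 0
  | insert a s ha ih => rw [Finset.sum_insert ha, Finset.sum_insert ha, rot_add, ih]

/-- When only the `j`-th module of the first MRS moves, a sum over the first MRS changes in one
term. -/
theorem sum_update {p p' : Config} {j : Fin 5} (h : ∀ i, i ≠ j → p' (0, i) = p (0, i))
    (g : Cell → ℤ) :
    ∑ i, g (p' (0, i)) + g (p (0, j)) = ∑ i, g (p (0, i)) + g (p' (0, j)) := by
  rw [← Finset.add_sum_erase _ _ (Finset.mem_univ j),
    ← Finset.add_sum_erase (a := j) _ (fun i => g (p (0, i))) (Finset.mem_univ j),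
    Finset.sum_congr rfl fun i hi => by rw [h i (Finset.ne_of_mem_erase hi)]]
  ring

theorem Compact.step {p : Config} {a : Module → Move} (hp : Compact p)
    (ha : LegalIn (fun _ => True) p a) (hv : AllVisible 9 (step p a)) : Compact (step p a) :=
  (ha.valid_step ⟨hp.injective, hp.connected, fun _ => trivial, hp.visible⟩ hv).compact

theorem Compact.step_single {p : Config} (hp : Compact p) (hmer : ¬ Merged p) {j : Fin 5}
    {v : Move} (hv : CanMove p (0, j) v) (hhull : ∀ c ∈ v.trajectory (p (0, j)), InHull p c) :
    Compact (MRS.step p (single (0, j) v)) :=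
  hp.step (legalIn_single hp.connected hmer hv fun _ _ => trivial)
    (allVisible_step hp.visible fun m => (inHull_step_single hv hhull m).nearHull)

theorem Compact.step_symmetric {p : Config} (hp : Compact p) (hmer : ¬ Merged p) {j : Fin 5}
    {v : Move} {c : Cell} (hc : Antipodal c p) (hv : CanMove p (0, j) v)
    (hhull : ∀ x ∈ v.trajectory (p (0, j)), NearHull p x)
    (hdisj : ∀ x ∈ v.trajectory (p (0, j)), ∀ y ∈ v.trajectory (p (0, j)), x + y ≠ c) :
    Compact (MRS.step p (symmetric j v)) := by
  have hleg : LegalIn (fun _ => True) p (symmetric j v) :=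
    legalIn_symmetric hp.connected hmer hc hv (fun _ _ _ => trivial) hdisj
  refine hp.step hleg (allVisible_step hp.visible fun m => ?_)
  rcases Move.eq_stay_or_dest_mem (hleg.guided m) with h | h
  · rw [MRS.step, h]; exact (inHull_self p m).nearHull
  · exact nearHull_symmetric hc hhull m _ h

/-- The first MRS and the cell `q` do not lie in a common row or column. -/
def NotCollinear (p : Config) (q : Cell) : Prop :=
  ∀ d : Direction, ∃ j, dot (p (0, j) - q) d.vec ≠ 0

/-- The sum of the squared distances of the modules of the first MRS from the cell `q`. -/
def potential (p : Config) (q : Cell) : ℤ := ∑ j, dot (p (0, j) - q) (p (0, j) - q)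

theorem potential_nonneg (p : Config) (q : Cell) : 0 ≤ potential p q :=
  Finset.sum_nonneg fun _ _ => add_nonneg (mul_self_nonneg _) (mul_self_nonneg _)

namespace NatCell

theorem sqDist_cast (z w : NatCell) :
    (sqDist z w : ℤ) = dot (toCell z - toCell w) (toCell z - toCell w) := by
  have : sqDist z w = gap z.1 w.1 * gap z.1 w.1 + gap z.2 w.2 * gap z.2 w.2 := rfl
  rw [this]
  push_cast
  rw [gap_cast, gap_cast, abs_mul_abs_self, abs_mul_abs_self]
  rfl

theorem inBox_inHull {p : Config} {s : List NatCell} {t : Cell} {q z : NatCell}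
    (hM : Models p firstMRS s t) {k : Module} (hq : p k = toCell q + t)
    (h : inBox s q z = true) : InHull p (toCell z + t) := by
  have key : ∀ w ∈ q :: s, ∃ m, p m = toCell w + t := by
    intro w hw
    rcases List.mem_cons.1 hw with rfl | hw
    · exact ⟨k, hq⟩
    · obtain ⟨m, -, hm⟩ := (hM _).2 ⟨w, hw, rfl⟩
      exact ⟨m, hm⟩
  simp only [inBox, Bool.and_eq_true, List.any_eq_true, Nat.ble_eq] at h
  obtain ⟨⟨⟨w₀, h₀, h₀'⟩, w₂, h₂, h₂'⟩, ⟨w₁, h₁, h₁'⟩, w₃, h₃, h₃'⟩ := h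
  intro d
  fin_cases d
  · obtain ⟨m, hm⟩ := key w₀ h₀
    exact ⟨m, by rw [hm]; simp [dot, Direction.vec, toCell]; omega⟩
  · obtain ⟨m, hm⟩ := key w₁ h₁
    exact ⟨m, by rw [hm]; simp [dot, Direction.vec, toCell]; omega⟩
  · obtain ⟨m, hm⟩ := key w₂ h₂
    exact ⟨m, by rw [hm]; simp [dot, Direction.vec, toCell]; omega⟩
  · obtain ⟨m, hm⟩ := key w₃ h₃
    exact ⟨m, by rw [hm]; simp [dot, Direction.vec, toCell]; omega⟩

theorem notCollinear_iff {p : Config} {s : List NatCell} {t : Cell} {q : NatCell}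
    (hM : Models p firstMRS s t) :
    notCollinear s q = true ↔ NotCollinear p (toCell q + t) := by
  have key : ∀ f : Cell → Prop, (∃ j, f (p (0, j))) ↔ ∃ z ∈ s, f (toCell z + t) := by
    intro f
    constructor
    · rintro ⟨j, hj⟩
      obtain ⟨z, hz, h⟩ := (hM _).1 ⟨(0, j), rfl, rfl⟩
      exact ⟨z, hz, h ▸ hj⟩
    · rintro ⟨z, hz, h⟩
      obtain ⟨⟨i, j⟩, hi, h'⟩ := (hM _).2 ⟨z, hz, rfl⟩
      obtain rfl : i = 0 := hi
      exact ⟨j, h' ▸ h⟩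
  refine Iff.trans ?_ (forall_congr' fun d : Direction =>
    (key fun c => dot (c - (toCell q + t)) d.vec ≠ 0).symm)
  simp only [notCollinear, Bool.and_eq_true, List.any_eq_true, Bool.not_eq_true',
    ← Bool.not_eq_true, Nat.beq_eq, add_sub_add_right_eq_sub, Fin.forall_fin_succ, dot,
    Direction.vec, toCell]
  simp [sub_eq_zero]
  intro x y h hx x' y' h' hy
  exact ⟨⟨x, ⟨y, h⟩, Ne.symm hx⟩, x', y', h', Ne.symm hy⟩

/-- What a movement in the model means for the configuration. -/
theorem Models.exists_single {p : Config} {s : List NatCell} {t : Cell} {q : NatCell} {k : Fin 5}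
    (hp : Compact p) (hmer : ¬ Merged p) (hM : Models p firstMRS s t)
    (hq : p (1, k) = toCell q + t) {m : LocalMove} (hm : m ∈ moves s)
    (hvia : inBox s q m.via = true) (hdst : inBox s q m.dst = true) :
    ∃ p', (Approaches p' → Approaches p) ∧ Compact p' ∧ p' (1, k) = toCell q + t ∧
      Models p' firstMRS (NatCell.update s m) t ∧ (∃ j, p' (0, j) = toCell m.dst + t) ∧
      potential p' (p (1, k)) + sqDist m.src q = potential p (p (1, k)) + sqDist m.dst q := by
  obtain ⟨j, hj, hv, htraj, hdest⟩ := hM.canMove hp.injective hm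
  have hhull : ∀ x ∈ m.v.trajectory (p (0, j)), InHull p x := by
    intro x hx
    rcases htraj x hx with rfl | rfl
    · exact inBox_inHull hM hq hvia
    · exact inBox_inHull hM hq hdst
  have hj' : step p (single (0, j) m.v) (0, j) = toCell m.dst + t := by
    rw [step_single_self, hdest]
  have hne : ∀ i, i ≠ j → step p (single (0, j) m.v) (0, i) = p (0, i) := fun i hi =>
    step_single_of_ne p (by simpa using hi) _
  refine ⟨step p (single (0, j) m.v), fun h => .step j m.v hv hhull h,
    hp.step_single hmer hv hhull, ?_, hM.update hp.injective hj hj' hne, ⟨j, hj'⟩, ?_⟩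
  · rw [step_single_of_ne p (by simp), hq]
  · have := sum_update hne fun c => dot (c - p (1, k)) (c - p (1, k))
    rw [hj', hj, hq, add_sub_add_right_eq_sub, add_sub_add_right_eq_sub, ← sqDist_cast,
      ← sqDist_cast, ← hq] at this
    exact this

theorem merged_of_near {p : Config} (hp : Compact p) {z w : NatCell} {t : Cell} {j k : Fin 5}
    (hz : p (0, j) = toCell z + t) (hw : p (1, k) = toCell w + t) (h : near z w = true) :
    Merged p := by
  rcases near_iff.1 h with rfl | h
  · simpa using hp.injective (hz.trans hw.symm)
  · refine merged_of_sideAdjacent hp.connected (m := (0, j)) (m' := (1, k)) (by simp) ?_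
    rw [hz, hw]
    simpa [rot_zero] using h.map_rot 0 t

theorem approaches_of_test {p : Config} {s : List NatCell} {t : Cell} {q : NatCell} {k : Fin 5}
    {b : ℕ} (hp : Compact p) (hM : Models p firstMRS s t) (hq : p (1, k) = toCell q + t)
    (ih : ∀ p', Compact p' → p' (1, k) = p (1, k) → NotCollinear p' (p (1, k)) →
      potential p' (p (1, k)) + b < potential p (p (1, k)) → Approaches p')
    (h : approaches s q b = true) : Approaches p := by
  by_cases hmer : Merged p
  · exact .merged hmer
  simp only [approaches, List.any_eq_true, Bool.and_eq_true, Bool.or_eq_true, Nat.ble_eq] at h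
  obtain ⟨m, hm, hprog, hvia, hdst⟩ := h
  obtain ⟨p', happ, hp', hk', hM', ⟨j, hj⟩, hpot⟩ := hM.exists_single hp hmer hq hm hvia hdst
  refine happ ?_
  rcases hprog with ⟨hlt, hnc⟩ | hnear
  · refine ih p' hp' (hk'.trans hq.symm) (hq ▸ (notCollinear_iff hM').1 hnc) ?_
    have hlt' : sqDist m.dst q + b < sqDist m.src q := hlt
    zify at hlt'
    linarith
  · exact .merged (merged_of_near hp' hj hk' hnear)

theorem approaches_of_testInTwo {p : Config} {s : List NatCell} {t : Cell} {q : NatCell}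
    {k : Fin 5} (hp : Compact p) (hM : Models p firstMRS s t)
    (hq : p (1, k) = toCell q + t)
    (ih : ∀ p', Compact p' → p' (1, k) = p (1, k) → NotCollinear p' (p (1, k)) →
      potential p' (p (1, k)) < potential p (p (1, k)) → Approaches p')
    (h : approachesInTwo s q = true) : Approaches p := by
  by_cases hmer : Merged p
  · exact .merged hmer
  simp only [approachesInTwo, List.any_eq_true, Bool.and_eq_true] at h
  obtain ⟨m, hm, ⟨hvia, hdst⟩, htest⟩ := h
  obtain ⟨p', happ, hp', hk', hM', -, hpot⟩ := hM.exists_single hp hmer hq hm hvia hdst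
  have hkk := hk'.trans hq.symm
  refine happ (approaches_of_test hp' hM' hk' (fun p'' h1 h2 h3 h4 => ?_) htest)
  rw [hkk] at h2 h3 h4
  refine ih p'' h1 h2 h3 ?_
  have : (sqDist m.dst q : ℤ) ≤ sqDist m.src q + (sqDist m.dst q - sqDist m.src q : ℕ) := by omega
  linarith

theorem belowAverage_of_nonneg {p : Config} {k : ℕ} {t : Cell}
    (hM : Models p firstMRS (decode k) t) (hp : Function.Injective p) (g : Cell → ℤ)
    (f : NatCell → ℕ) (a : ℕ) (hg : ∀ z, g (toCell z + t) = f z - a)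
    (h : 0 ≤ ∑ j, g (p (0, j))) : belowAverage (decode k) f a = true := by
  rw [hM.sum_eq hp] at h
  have hsum : ∀ l : List NatCell, (l.map fun z => (f z : ℤ) - a).sum =
      ((l.map f).sum : ℕ) - ((l.map fun _ => a).sum : ℕ) := by
    intro l
    induction l with
    | nil => simp
    | cons z l ih => simp only [List.map_cons, List.sum_cons, ih]; push_cast; ring
  simp only [hg, hsum] at h
  rw [belowAverage, Nat.ble_eq]
  omega

theorem exists_natCell {c : Cell} (h1 : 0 ≤ c.1) (h2 : 0 ≤ c.2) : ∃ z : NatCell, toCell z = c :=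
  ⟨(c.1.toNat, c.2.toNat), by simp [toCell, h1, h2]⟩

theorem approachable_of_mem {k : ℕ} (hk : k ∈ polyominoes 4) {q : NatCell} (h1 : q.1 < 25)
    (h2 : q.2 < 25) (hx : within (decode k) Prod.fst q.1 = true)
    (hy : within (decode k) Prod.snd q.2 = true)
    (hx' : belowAverage (decode k) Prod.fst q.1 = true)
    (hy' : belowAverage (decode k) Prod.snd q.2 = true) : approachable (decode k) q = true := by
  have := allApproachable_eq_true
  simp only [allApproachable, List.all_eq_true, List.mem_range, Bool.or_eq_true] at this
  have := (this k hk q.1 h1).resolve_left (by simp [hx, hx'])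
  exact (this q.2 h2).resolve_left (by simp [hy, hy'])

end NatCell

open NatCell in
theorem approaches_of_notCollinear {p : Config} (hp : Compact p) {k : Fin 5}
    (hnc : NotCollinear p (p (1, k))) : Approaches p := by
  generalize hN : (potential p (p (1, k))).toNat = N
  induction N using Nat.strong_induction_on generalizing p with
  | _ N ih =>
    subst hN
    obtain ⟨θ, hθ1, hθ2⟩ := exists_rot_nonneg (∑ j, (p (0, j) - p (1, k)))
    -- Without loss of generality, `q` lies to the lower left of the first MRS.
    let p' : Config := fun m => rot θ (p m) + 0
    have hsim : Similar θ 0 1 p p' := ⟨fun _ => rfl, fun _ _ => Iff.rfl⟩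
    have hsub : ∀ j, p' (0, j) - p' (1, k) = rot θ (p (0, j) - p (1, k)) :=
      fun j => hsim.sub_eq _ _
    have hpot : potential p' (p' (1, k)) = potential p (p (1, k)) := by
      simp only [potential, hsub, dot_rot]
    have hnc' : NotCollinear p' (p' (1, k)) := by
      intro d
      obtain ⟨j, hj⟩ := hnc (-θ + d)
      refine ⟨j, ?_⟩
      rw [hsub, ← add_neg_cancel_left θ d, dot_rot_vec]
      exact hj
    have hp' := hp.similar hsim
    rw [rot_sum] at hθ1 hθ2
    simp only [← hsub] at hθ1 hθ2
    refine Approaches.similar (t := -rot (-θ) 0) (p := p') (θ := -θ) hsim.symm ?_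
    have ih' : ∀ p'', Compact p'' → p'' (1, k) = p' (1, k) → NotCollinear p'' (p' (1, k)) →
        potential p'' (p' (1, k)) < potential p' (p' (1, k)) → Approaches p'' := by
      intro p'' h1 h2 h3 h4
      rw [hpot] at h4
      rw [← h2] at h3 h4
      refine ih _ ?_ h1 h3 rfl
      have := potential_nonneg p'' (p'' (1, k))
      omega
    clear_value p'
    clear ih hsim hsub hpot hp hnc
    obtain ⟨l, hl, t, hM⟩ := exists_models_firstMRS hp'
    have hdist : ∀ z ∈ decode l, |(p' (1, k) - t).1 - z.1| ≤ 9 ∧ |(p' (1, k) - t).2 - z.2| ≤ 9 := by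
      intro z hz
      obtain ⟨m, -, hm⟩ := (hM _).2 ⟨z, hz, rfl⟩
      have := hp'.visible m (1, k)
      rw [hm] at this
      simp only [InRange, toCell, Prod.fst_sub, Prod.snd_sub, Prod.fst_add, Prod.snd_add] at this ⊢
      push_cast at this
      constructor
      · convert this.1 using 2; ring
      · convert this.2 using 2; ring
    obtain ⟨z₀, hz₀, -⟩ := (hM _).1 ⟨(0, 0), rfl, rfl⟩
    have hb₀ := decode_bounds hz₀
    have hd₀ := hdist z₀ hz₀
    rw [abs_le, abs_le] at hd₀
    obtain ⟨q, hq⟩ := exists_natCell (c := p' (1, k) - t) (by omega) (by omega)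
    rw [← hq] at hdist hd₀
    have hqt : p' (1, k) = toCell q + t := by rw [hq]; abel
    simp only [toCell] at hdist hd₀
    have htest : approachable (decode l) q = true := by
      refine approachable_of_mem hl (by omega) (by omega) ?_ ?_ ?_ ?_
      · simp only [within, List.all_eq_true, Nat.ble_eq]
        intro z hz
        zify
        rw [gap_cast, abs_sub_comm]
        exact (hdist z hz).1
      · simp only [within, List.all_eq_true, Nat.ble_eq]
        intro z hz
        zify
        rw [gap_cast, abs_sub_comm]
        exact (hdist z hz).2
      · refine belowAverage_of_nonneg hM hp'.injective (fun c => (c - p' (1, k)).1) _ _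
          (fun z => ?_) (by simpa [Prod.fst_sum] using hθ1)
        rw [hqt]; simp [toCell]
      · refine belowAverage_of_nonneg hM hp'.injective (fun c => (c - p' (1, k)).2) _ _
          (fun z => ?_) (by simpa [Prod.snd_sum] using hθ2)
        rw [hqt]; simp [toCell]
    simp only [approachable, Bool.or_eq_true, Bool.not_eq_true', List.any_eq_true] at htest
    rcases htest with ((htest | ⟨z, hz, htest⟩) | htest) | htest
    · rw [hqt, ← notCollinear_iff hM, htest] at hnc'
      simp at hnc'
    · obtain ⟨⟨i, j⟩, hi, hj⟩ := (hM _).2 ⟨z, hz, rfl⟩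
      obtain rfl : i = 0 := hi
      refine .merged (merged_of_near hp' hj hqt ?_)
      rw [near_iff] at htest ⊢
      exact htest.imp Eq.symm SideAdjacent.symm
    · exact approaches_of_test hp' hM hqt (by simpa using ih') htest
    · exact approaches_of_testInTwo hp' hM hqt ih' htest

/-! ### Modules in a common row or column -/

theorem eq_zero_of_dot_eq_zero {u : Cell} {d : Direction} (h : dot u d.vec = 0)
    (h' : dot u (Direction.vec (d + 1)) = 0) : u = 0 := by
  fin_cases d <;> simp [dot, Direction.vec, Prod.ext_iff] at * <;> omega

theorem eq_vec_of_dot {u : Cell} {d : Direction} (h : dot u d.vec = 0)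
    (h' : dot u (Direction.vec (d + 1)) = 1) : u = Direction.vec (d + 1) := by
  fin_cases d <;> simp [dot, Direction.vec, Prod.ext_iff] at * <;> omega

theorem dot_eq_zero_of_dot_eq_zero {u w : Cell} {d e : Direction} (hu : u ≠ 0)
    (hd : dot u d.vec = 0) (he : dot u e.vec = 0) (hw : dot w e.vec = 0) : dot w d.vec = 0 := by
  fin_cases d <;> fin_cases e <;> simp [dot, Direction.vec, Prod.ext_iff] at * <;> omega

/-- Ten modules on a line that see each other leave no gap. -/
theorem merged_of_dot_eq_zero {p : Config} (hp : Compact p) {d : Direction}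
    (hd : ∀ m m', dot (p m - p m') d.vec = 0) : Merged p := by
  let y : Module → ℤ := fun m => dot (p m) (Direction.vec (d + 1))
  have hy : ∀ m m', y m - y m' = dot (p m - p m') (Direction.vec (d + 1)) := fun m m' =>
    (dot_sub_left _ _ _).symm
  have hinj : Function.Injective y := fun m m' h => hp.injective <| sub_eq_zero.1 <|
    eq_zero_of_dot_eq_zero (hd m m') (by rw [← hy, h, sub_self])
  obtain ⟨m₀, hm₀⟩ := Finite.exists_min y
  have himage : Finset.univ.image y = Finset.Icc (y m₀) (y m₀ + 9) := by
    refine Finset.eq_of_subset_of_card_le (fun n hn => ?_) ?_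
    · obtain ⟨m, -, rfl⟩ := Finset.mem_image.1 hn
      have := inRange_iff_dot.1 (hp.visible m₀ m) (d + 1)
      rw [← hy] at this
      push_cast at this
      exact Finset.mem_Icc.2 ⟨hm₀ m, by omega⟩
    · rw [Finset.card_image_of_injective _ hinj, Int.card_Icc]
      simp only [Finset.card_univ, Fintype.card_prod, Fintype.card_fin]
      omega
  have hle : ∀ m, y m ≤ y m₀ + 9 := fun m =>
    (Finset.mem_Icc.1 (himage ▸ Finset.mem_image_of_mem y (Finset.mem_univ m))).2
  have key : ∀ n : ℕ, ∀ m m' : Module, m.1 ≠ m'.1 → y m' = y m + n → Merged p := by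
    intro n
    induction n with
    | zero =>
      intro m m' hne h
      exact absurd (congrArg Prod.fst (hinj (a₁ := m) (a₂ := m') (by simpa using h.symm))) hne
    | succ n ih =>
      intro m m' hne h
      push_cast at h
      have hmem : y m + 1 ∈ Finset.univ.image y := by
        rw [himage, Finset.mem_Icc]
        have := hm₀ m
        have := hle m'
        omega
      obtain ⟨m'', -, h''⟩ := Finset.mem_image.1 hmem
      by_cases h1 : m''.1 = m.1
      · exact ih m'' m' (h1 ▸ hne) (by omega)
      · refine merged_of_sideAdjacent hp.connected h1 (SideAdjacent.symm
          (sideAdjacent_iff_exists_vec.2 ⟨d + 1, ?_⟩))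
        rw [← eq_vec_of_dot (hd m'' m) (by rw [← hy]; omega)]
        abel
  rcases le_total (y (0, 0)) (y (1, 0)) with h | h
  · exact key (y (1, 0) - y (0, 0)).toNat (0, 0) (1, 0) (by simp) (by omega)
  · exact key (y (0, 0) - y (1, 0)).toNat (1, 0) (0, 0) (by simp) (by omega)

theorem exists_notCollinear {p : Config} (hp : Compact p) (hmer : ¬ Merged p) :
    ∃ k, NotCollinear p (p (1, k)) := by
  by_contra! h
  simp only [NotCollinear, not_forall, not_exists, not_not] at h
  choose d hd using h
  refine hmer (merged_of_dot_eq_zero hp (d := d 0) ?_)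
  have hsub : ∀ k, dot (p (0, 1) - p (0, 0)) (d k).vec = 0 := fun k => by
    have h0 := hd k 0
    have h1 := hd k 1
    rw [dot_sub_left] at *
    omega
  have hne : p (0, 1) - p (0, 0) ≠ 0 := sub_ne_zero.2 fun h => by simpa using hp.injective h
  have h1 : ∀ k j, dot (p (0, j) - p (1, k)) (d 0).vec = 0 := fun k j =>
    dot_eq_zero_of_dot_eq_zero hne (hsub 0) (hsub k) (hd k j)
  have h2 : ∀ m, dot (p m) (d 0).vec = dot (p (0, 0)) (d 0).vec := by
    rintro ⟨i, j⟩
    fin_cases i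
    · have e1 := h1 0 0
      have e2 := h1 0 j
      rw [dot_sub_left] at e1 e2
      change dot (p (0, j)) _ = _
      omega
    · have e1 := h1 j 0
      rw [dot_sub_left] at e1
      change dot (p (1, j)) _ = _
      omega
  intro m m'
  rw [dot_sub_left, h2 m, h2 m', sub_self]

theorem approaches_of_compact {p : Config} (hp : Compact p) : Approaches p := by
  by_cases hmer : Merged p
  · exact .merged hmer
  · obtain ⟨k, hk⟩ := exists_notCollinear hp hmer
    exact approaches_of_notCollinear hp hk

/-! ### Two MRSs approach each other symmetrically -/

/-- The sum of the squared lengths of the vectors `2 * x - c`, where `x` runs through the cells of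
the first MRS: four times the sum of the squared distances from the center of symmetry. -/
def symmetricPotential (p : Config) (c : Cell) : ℤ :=
  ∑ j, dot (p (0, j) + p (0, j) - c) (p (0, j) + p (0, j) - c)

theorem symmetricPotential_nonneg (p : Config) (c : Cell) : 0 ≤ symmetricPotential p c :=
  Finset.sum_nonneg fun _ _ => add_nonneg (mul_self_nonneg _) (mul_self_nonneg _)

namespace NatCell

theorem toCell_double (z : NatCell) : toCell (double z) = toCell z + toCell z := by
  simp [toCell, double]

theorem toCell_sum (z w : NatCell) : toCell (sum z w) = toCell z + toCell w := by
  simp [toCell, sum]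

section

variable {p : Config} {s : List NatCell} {t : Cell} {c : NatCell}

theorem inWidth_sound (hM : Models p firstMRS s t) (hc : Antipodal (toCell c + (t + t)) p)
    {X : Cell →+ ℤ} {x : NatCell → ℕ} (hx : ∀ z, X (toCell z) = x z) {d : Direction}
    (hd : ∀ u, dot u d.vec = X u) {z : NatCell} (h : inWidth s x (x c) (x z) = true)
    {e : Direction} (he : e = d ∨ e = d + 2) :
    ∃ m, dot (toCell z + t - p m) e.vec ≤ 0 ∨
      Thin p e ∧ dot (toCell z + t - p m) e.vec ≤ 1 := by
  have hd' : ∀ u, dot u (Direction.vec (d + 2)) = -X u := fun u => by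
    rw [vec_add_two, dot_neg_right, hd]
  rw [antipodal_iff] at hc
  have hX : ∀ j, X (p (1, j)) = x c + (X t + X t) - X (p (0, j)) := fun j => by
    rw [hc, map_sub, map_add, map_add, hx]
  have hcells : ∀ w ∈ s, ∃ j, X (p (0, j)) = x w + X t := by
    intro w hw
    obtain ⟨⟨i, j⟩, hi, hj⟩ := (hM _).2 ⟨w, hw, rfl⟩
    obtain rfl : i = 0 := hi
    exact ⟨j, by rw [hj, map_add, hx]⟩
  have hmodules : ∀ m, ∃ w ∈ s, X (p m) = x w + X t ∨ X (p m) = x c + X t - x w := by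
    rintro ⟨i, j⟩
    obtain ⟨w, hw, h⟩ := (hM (p (0, j))).1 ⟨(0, j), rfl, rfl⟩
    have h0 : X (p (0, j)) = x w + X t := by rw [h, map_add, hx]
    refine ⟨w, hw, ?_⟩
    fin_cases i
    · exact Or.inl h0
    · exact Or.inr ((hX j).trans (by rw [h0]; ring))
  have hthin : width s x (x c) 2 = true → Thin p d := by
    intro hw m m'
    simp only [width, List.all_eq_true, Nat.ble_eq] at hw
    have key : ∀ w ∈ s, |(x w + x w : ℤ) - x c| ≤ 2 := fun w hws => by
      have := hw w hws
      zify at this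
      rw [gap_cast] at this
      simpa using this
    obtain ⟨w, hws, h1⟩ := hmodules m
    obtain ⟨w', hws', h2⟩ := hmodules m'
    have e1 := abs_le.1 (key w hws)
    have e2 := abs_le.1 (key w' hws')
    rw [hd, map_sub]
    omega
  simp only [inWidth, Bool.and_eq_true, List.any_eq_true, Bool.or_eq_true, Nat.ble_eq,
    Nat.add_eq] at h
  obtain ⟨⟨w, hw, h1⟩, w', hw', h2⟩ := h
  obtain ⟨j, hj⟩ := hcells w hw
  obtain ⟨j', hj'⟩ := hcells w' hw'
  have hXj := hX j
  have hXj' := hX j'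
  have main : ∀ k : ℕ, (width s x (x c) 2).toNat = k →
      ∃ m, dot (toCell z + t - p m) e.vec ≤ k := by
    rintro k hk
    rw [hk] at h1 h2
    rcases he with rfl | rfl
    · rcases h1 with h1 | h1
      · exact ⟨(0, j), by rw [hd, map_sub, map_add, hx]; omega⟩
      · exact ⟨(1, j), by rw [hd, map_sub, map_add, hx]; omega⟩
    · rcases h2 with h2 | h2
      · exact ⟨(0, j'), by rw [hd', map_sub, map_add, hx]; omega⟩
      · exact ⟨(1, j'), by rw [hd', map_sub, map_add, hx]; omega⟩
  by_cases hw : width s x (x c) 2 = true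
  · obtain ⟨m, hm⟩ := main 1 (by simp [hw])
    refine ⟨m, Or.inr ⟨?_, by simpa using hm⟩⟩
    rcases he with rfl | rfl
    · exact hthin hw
    · exact (hthin hw).opposite
  · obtain ⟨m, hm⟩ := main 0 (by simp [hw])
    exact ⟨m, Or.inl (by simpa using hm)⟩

theorem inSymmetricBox_nearHull (hM : Models p firstMRS s t)
    (hc : Antipodal (toCell c + (t + t)) p) {z : NatCell} (h : inSymmetricBox s c z = true) :
    NearHull p (toCell z + t) := by
  rw [inSymmetricBox, Bool.and_eq_true] at h
  have h1 := @inWidth_sound p s t c hM hc (AddMonoidHom.fst ℤ ℤ) Prod.fst (fun _ => rfl) 0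
    (fun u => by simp [dot, Direction.vec]) z h.1
  have h2 := @inWidth_sound p s t c hM hc (AddMonoidHom.snd ℤ ℤ) Prod.snd (fun _ => rfl) 1
    (fun u => by simp [dot, Direction.vec]) z h.2
  intro e
  fin_cases e
  · exact h1 (Or.inl rfl)
  · exact h2 (Or.inl rfl)
  · exact h1 (Or.inr rfl)
  · exact h2 (Or.inr rfl)

theorem disjointFromImage_sound {m : LocalMove} (h : disjointFromImage c m = true) {x y : Cell}
    (hx : x = toCell m.via + t ∨ x = toCell m.dst + t)
    (hy : y = toCell m.via + t ∨ y = toCell m.dst + t) : x + y ≠ toCell c + (t + t) := by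
  simp only [disjointFromImage, Bool.and_eq_true, Bool.not_eq_true', ← Bool.not_eq_true,
    same_iff] at h
  obtain ⟨⟨h1, h2⟩, h3⟩ := h
  have key : ∀ z w, sum z w ≠ c → toCell z + t + (toCell w + t) ≠ toCell c + (t + t) := by
    intro z w hne e
    refine hne (toCell_injective (add_right_cancel (b := t + t) ?_))
    rw [toCell_sum, ← e]; abel
  rcases hx with rfl | rfl <;> rcases hy with rfl | rfl
  · exact key _ _ h1
  · exact key _ _ h3
  · rw [add_comm]; exact key _ _ h3
  · exact key _ _ h2

/-- What a symmetric movement in the model means for the configuration. -/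
theorem Models.exists_symmetric (hp : Compact p) (hmer : ¬ Merged p) (hM : Models p firstMRS s t)
    (hc : Antipodal (toCell c + (t + t)) p) {m : LocalMove} (hm : m ∈ moves s)
    (hdisj : disjointFromImage c m = true) (hvia : inSymmetricBox s c m.via = true)
    (hdst : inSymmetricBox s c m.dst = true) :
    ∃ p', (SymmetricallyApproaches (toCell c + (t + t)) p' →
        SymmetricallyApproaches (toCell c + (t + t)) p) ∧
      Compact p' ∧ Antipodal (toCell c + (t + t)) p' ∧
      Models p' firstMRS (NatCell.update s m) t ∧ (∃ j, p' (0, j) = toCell m.dst + t) ∧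
      symmetricPotential p' (toCell c + (t + t)) + sqDist (double m.src) c =
        symmetricPotential p (toCell c + (t + t)) + sqDist (double m.dst) c := by
  obtain ⟨j, hj, hv, htraj, hdest⟩ := hM.canMove hp.injective hm
  have hhull : ∀ x ∈ m.v.trajectory (p (0, j)), NearHull p x := by
    intro x hx
    rcases htraj x hx with rfl | rfl
    · exact inSymmetricBox_nearHull hM hc hvia
    · exact inSymmetricBox_nearHull hM hc hdst
  have hdisj' : ∀ x ∈ m.v.trajectory (p (0, j)), ∀ y ∈ m.v.trajectory (p (0, j)),
      x + y ≠ toCell c + (t + t) := fun x hx y hy =>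
    disjointFromImage_sound hdisj (htraj x hx) (htraj y hy)
  have hj' : step p (symmetric j m.v) (0, j) = toCell m.dst + t := by
    simpa [step, symmetric] using hdest
  have hne : ∀ i, i ≠ j → step p (symmetric j m.v) (0, i) = p (0, i) := fun i hi => by
    simp [step, symmetric, hi, Move.dest]
  have hc' := Similar.step hc (symmetric j m.v)
  rw [transport_flip_symmetric] at hc'
  refine ⟨step p (symmetric j m.v), fun h => .step j m.v hv hhull hdisj' h,
    hp.step_symmetric hmer hc hv hhull hdisj', hc', hM.update hp.injective hj hj' hne,
    ⟨j, hj'⟩, ?_⟩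
  have := sum_update hne fun x =>
    dot (x + x - (toCell c + (t + t))) (x + x - (toCell c + (t + t)))
  have e : ∀ z, toCell z + t + (toCell z + t) - (toCell c + (t + t)) =
      toCell (double z) - toCell c := fun z => by rw [toCell_double]; abel
  rw [hj', hj, e, e, ← sqDist_cast, ← sqDist_cast] at this
  exact this

theorem merged_of_near_sum (hp : Compact p) (hM : Models p firstMRS s t)
    (hc : Antipodal (toCell c + (t + t)) p) {z w : NatCell} {j : Fin 5}
    (hz : p (0, j) = toCell z + t) (hw : w ∈ s) (h : near (sum z w) c = true) : Merged p := by
  obtain ⟨⟨i, k⟩, hi, hk⟩ := (hM _).2 ⟨w, hw, rfl⟩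
  obtain rfl : i = 0 := hi
  have h1 : p (1, k) = toCell c + (t - toCell w) := by
    rw [antipodal_iff.1 hc, hk]; abel
  have h0 : p (0, j) = toCell (sum z w) + (t - toCell w) := by
    rw [hz, toCell_sum]; abel
  exact merged_of_near hp h0 h1 h

theorem symmetricallyApproaches_of_test {b : ℕ} (hp : Compact p) (hM : Models p firstMRS s t)
    (hc : Antipodal (toCell c + (t + t)) p)
    (ih : ∀ p', Compact p' → Antipodal (toCell c + (t + t)) p' →
      symmetricPotential p' (toCell c + (t + t)) + b < symmetricPotential p (toCell c + (t + t)) →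
      SymmetricallyApproaches (toCell c + (t + t)) p')
    (h : approachesSymmetrically s c b = true) :
    SymmetricallyApproaches (toCell c + (t + t)) p := by
  by_cases hmer : Merged p
  · exact .merged hmer
  simp only [approachesSymmetrically, List.any_eq_true, Bool.and_eq_true, Bool.or_eq_true,
    Nat.ble_eq] at h
  obtain ⟨m, hm, hprog, hdisj, hvia, hdst⟩ := h
  obtain ⟨p', happ, hp', hc', hM', ⟨j, hj⟩, hpot⟩ :=
    hM.exists_symmetric hp hmer hc hm hdisj hvia hdst
  refine happ ?_
  rcases hprog with hlt | ⟨w, hw, hnear⟩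
  · refine ih p' hp' hc' ?_
    have hlt' : sqDist (double m.dst) c + b < sqDist (double m.src) c := hlt
    zify at hlt'
    linarith
  · exact .merged (merged_of_near_sum hp' hM' hc' hj hw hnear)

theorem symmetricallyApproaches_of_testInTwo (hp : Compact p) (hM : Models p firstMRS s t)
    (hc : Antipodal (toCell c + (t + t)) p)
    (ih : ∀ p', Compact p' → Antipodal (toCell c + (t + t)) p' →
      symmetricPotential p' (toCell c + (t + t)) < symmetricPotential p (toCell c + (t + t)) →
      SymmetricallyApproaches (toCell c + (t + t)) p')
    (h : approachesSymmetricallyInTwo s c = true) :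
    SymmetricallyApproaches (toCell c + (t + t)) p := by
  by_cases hmer : Merged p
  · exact .merged hmer
  simp only [approachesSymmetricallyInTwo, List.any_eq_true, Bool.and_eq_true] at h
  obtain ⟨m, hm, ⟨hdisj, hvia, hdst⟩, htest⟩ := h
  obtain ⟨p', happ, hp', hc', hM', -, hpot⟩ :=
    hM.exists_symmetric hp hmer hc hm hdisj hvia hdst
  refine happ (symmetricallyApproaches_of_test hp' hM' hc' (fun p'' h1 h2 h3 => ?_) htest)
  refine ih p'' h1 h2 ?_
  have : (sqDist (double m.dst) c : ℤ) ≤ sqDist (double m.src) c +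
      (sqDist (double m.dst) c - sqDist (double m.src) c : ℕ) := by omega
  linarith

end

theorem symmetricallyApproachable_of_mem {k : ℕ} (hk : k ∈ polyominoes 4) {c : NatCell}
    (h1 : c.1 < 40) (h2 : c.2 < 40) (hx : width (decode k) Prod.fst c.1 9 = true)
    (hy : width (decode k) Prod.snd c.2 9 = true)
    (hx' : belowAverage (decode k) (fun z => z.1 + z.1) c.1 = true)
    (hy' : belowAverage (decode k) (fun z => z.2 + z.2) c.2 = true) :
    symmetricallyApproachable (decode k) c = true := by
  have := allSymmetricallyApproachable_eq_true
  simp only [allSymmetricallyApproachable, List.all_eq_true, List.mem_range,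
    Bool.or_eq_true] at this
  have := (this k hk c.1 h1).resolve_left (by simp [hx, hx'])
  exact (this c.2 h2).resolve_left (by simp [hy, hy'])

end NatCell

open NatCell in
theorem symmetricallyApproaches_of_compact {c : Cell} {p : Config} (hp : Compact p)
    (hc : Antipodal c p) : SymmetricallyApproaches c p := by
  generalize hN : (symmetricPotential p c).toNat = N
  induction N using Nat.strong_induction_on generalizing p c with
  | _ N ih =>
    subst hN
    obtain ⟨θ, hθ1, hθ2⟩ := exists_rot_nonneg (∑ j, (p (0, j) + p (0, j) - c))
    -- Without loss of generality, the center lies to the lower left of the first MRS.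
    let p' : Config := fun m => rot θ (p m) + 0
    let c' : Cell := rot θ c
    have hsim : Similar θ 0 1 p p' := ⟨fun _ => rfl, fun _ _ => Iff.rfl⟩
    have hsub : ∀ j, p' (0, j) + p' (0, j) - c' = rot θ (p (0, j) + p (0, j) - c) := fun j => by
      simp only [p', c', rot_sub, rot_add, add_zero]
    have hpot : symmetricPotential p' c' = symmetricPotential p c := by
      simp only [symmetricPotential, hsub, dot_rot]
    have hc' : Antipodal c' p' := by
      rw [antipodal_iff] at hc ⊢
      intro j
      simp only [p', c', hc, rot_sub, add_zero]
    have hp' := hp.similar hsim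
    rw [rot_sum] at hθ1 hθ2
    simp only [← hsub] at hθ1 hθ2
    suffices h : SymmetricallyApproaches c' p' by
      have := h.similar hsim.symm
      have e : -rot (-θ) 0 = 0 := by simpa using (rot_zsmul (-θ) 0 0)
      rw [e, add_zero, add_zero, rot_neg_rot] at this
      exact this
    have ih' : ∀ p'', Compact p'' → Antipodal c' p'' →
        symmetricPotential p'' c' < symmetricPotential p' c' →
        SymmetricallyApproaches c' p'' := by
      intro p'' h1 h2 h3
      rw [hpot] at h3
      refine ih _ ?_ h1 h2 rfl
      have := symmetricPotential_nonneg p'' c'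
      omega
    clear_value p' c'
    clear ih hsim hsub hpot hp hc
    obtain ⟨l, hl, t, hM⟩ := exists_models_firstMRS hp'
    have hdist : ∀ z ∈ decode l, |(z.1 + z.1 : ℤ) - (c' - (t + t)).1| ≤ 9 ∧
        |(z.2 + z.2 : ℤ) - (c' - (t + t)).2| ≤ 9 := by
      intro z hz
      obtain ⟨⟨i, j⟩, hi, hj⟩ := (hM _).2 ⟨z, hz, rfl⟩
      obtain rfl : i = 0 := hi
      have := hp'.visible (1, j) (0, j)
      rw [antipodal_iff.1 hc', hj] at this
      simp only [InRange, toCell, Prod.fst_sub, Prod.snd_sub, Prod.fst_add, Prod.snd_add] at this ⊢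
      push_cast at this
      constructor
      · convert this.1 using 2; ring
      · convert this.2 using 2; ring
    obtain ⟨z₀, hz₀, -⟩ := (hM _).1 ⟨(0, 0), rfl, rfl⟩
    have hb₀ := decode_bounds hz₀
    have hd₀ := hdist z₀ hz₀
    rw [abs_le, abs_le] at hd₀
    obtain ⟨q, hq⟩ := exists_natCell (c := c' - (t + t)) (by omega) (by omega)
    rw [← hq] at hdist hd₀
    obtain rfl : c' = toCell q + (t + t) := by rw [hq]; abel
    simp only [toCell] at hdist hd₀
    have htest : symmetricallyApproachable (decode l) q = true := by
      refine symmetricallyApproachable_of_mem hl (by omega) (by omega) ?_ ?_ ?_ ?_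
      · simp only [width, List.all_eq_true, Nat.ble_eq]
        intro z hz
        zify
        rw [gap_cast]
        simpa using (hdist z hz).1
      · simp only [width, List.all_eq_true, Nat.ble_eq]
        intro z hz
        zify
        rw [gap_cast]
        simpa using (hdist z hz).2
      · refine belowAverage_of_nonneg hM hp'.injective
          (fun x => (x + x - (toCell q + (t + t))).1) _ _
          (fun z => ?_) (by simpa only [Prod.fst_sum] using hθ1)
        simp [toCell]; ring
      · refine belowAverage_of_nonneg hM hp'.injective
          (fun x => (x + x - (toCell q + (t + t))).2) _ _
          (fun z => ?_) (by simpa only [Prod.snd_sum] using hθ2)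
        simp [toCell]; ring
    simp only [symmetricallyApproachable, Bool.or_eq_true, List.any_eq_true] at htest
    rcases htest with (htest | ⟨z, hz, w, hw, htest⟩) | htest
    · exact symmetricallyApproaches_of_test hp' hM hc' (by simpa using ih') htest
    · obtain ⟨⟨i, j⟩, hi, hj⟩ := (hM _).2 ⟨z, hz, rfl⟩
      obtain rfl : i = 0 := hi
      exact .merged (merged_of_near_sum hp' hM hc' hj hw htest)
    · exact symmetricallyApproaches_of_testInTwo hp' hM hc' ih' htest

end MRS

theorem theorem2 :
    ∃ A : MRS.Algorithm 9, ∀ w h : ℕ, 4 ≤ w → 4 ≤ h → ∀ p : MRS.Config,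
      MRS.IsConfiguration w h p → MRS.AllVisible 9 p → A.SolvesMergeFrom w h p :=
  MRS.exists_algorithm_of_winnable fun F p _ hp =>
    MRS.winnable_of_compact (fun _ h => MRS.approaches_of_compact h)
      (fun _ _ h hc => MRS.symmetricallyApproaches_of_compact h hc) (MRS.touching F p) hp.compact
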